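/- Let $d,p\ge 1$, $\mathcal T=\mathbb R^p$, $\alpha>0$, let $\|\cdot\|$ be a norm on $\mathbb R^d$, and let $C$ be the space of continuous functions $f=(f_1,\dots,f_d):\mathcal T\to[0,\infty)^d$ with the $\sigma$-field $\mathcal C$ generated by the evaluation maps. Write $(B^hf)(t)=f(t-h)$ for $h,t\in\mathcal T$. A process $Z$ with paths in $C$ is called a spectral process of a process $X$ with paths in $C$ if $X$ has the same law (finite-dimensional distributions) as $\max_{i\ge1}\Gamma_i^{-1/\alpha}Z^{(i)}(t)$, $t\in\mathcal T$, where the $Z^{(i)}$ are independent copies of $Z$, and $\Gamma_i=E_1+\dots+E_i$ with $E_1,E_2,\dots$ i.i.d. unit exponential random variables independent of the $Z^{(i)}$. Let $X$ be a (max-stable) process with paths in $C$ that has a spectral process $Z$ with paths in $C$ such that $\mathbb P(\sup_{t\in\mathcal T}\|Z(t)\|>0)=1$ and $\mathbb E\|Z(t)\|^\alpha=1$ for all $t\in\mathcal T$. Let $\Theta$ be a process with paths in $C$ and law $$\mathbb P(\Theta\in A)=\mathbb E\big[\|Z(0)\|^\alpha\,\mathbb 1(Z/\|Z(0)\|\in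 A)\big],\qquad A\in\mathcal C.$$ For $h\in\mathcal T$ and $1\le k\le d$ let $\Theta^{[h,k]}$ be a process with paths in $C$ and law $$\mathbb P(\Theta^{[h,k]}\in A)=\frac{\mathbb E\big[Z_k(h)^\alpha\,\mathbb 1(Z/Z_k(h)\in A)\big]}{\mathbb E[Z_k(h)^\alpha]},\qquad A\in\mathcal C,$$ if $\mathbb E[Z_k(h)^\alpha]>0$, and let $\Theta^{[h,k]}$ be the constant path $(1,\dots,1)$ if $\mathbb E[Z_k(h)^\alpha]=0$. Call $X$ stationary if $B^hX$ and $X$ have the same law for every $h\in\mathcal T$. Then stationarity of $X$ is equivalent to each one of the following three conditions. (i) For every $\mathbb Q^p$-valued random variable $W$ that is independent of $\Theta$ and satisfies $q(s):=\mathbb P(W=s)>0$ for all $s\in\mathbb Q^p$, the process $$Z_W(t)=\frac{\Theta(t-W)}{\big(\sum_{s\in\mathbb Q^p}\|\Theta(s-W)\|^\alpha q(s)\big)^{1/\alpha}},\qquad t\in\mathcal T,$$ is a spectral process of $X$. (ii) For all $h\in\mathcal T$, all $1\le k\le d$ and all measurable $\Gamma:C\to[0,\infty]$ with $\Gamma(cf)=\Gamma(f)$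 for all $c>0$ and $f\in C$, $$\mathbb E[Z_k(h)^\alpha\,\Gamma(Z)]=\mathbb E[Z_k(0)^\alpha\,\Gamma(B^hZ)],$$ with the convention $0\cdot\infty=0$. (iii) For all $h\in\mathcal T$ and all $1\le k\le d$, $\Theta^{[h,k]}$ has the same law as $B^h\Theta^{[0,k]}$. -/

import Mathlib

open MeasureTheory ProbabilityTheory
open scoped NNReal ENNReal

noncomputable section

namespace MaxStable

/-- The space `C` of continuous functions `ℝᵖ → [0, ∞)ᵈ`. -/
abbrev PathSpace (p d : ℕ) : Type := C(Fin p → ℝ, Fin d → ℝ≥0)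

/-- The σ-field on `C` generated by the evaluation maps `f ↦ f t`. By continuity of the paths, the
evaluations at the points `t` of a dense countable set generate the same σ-field. -/
instance instMeasurableSpacePathSpace (p d : ℕ) : MeasurableSpace (PathSpace p d) :=
  ⨆ t : Fin p → ℝ, MeasurableSpace.comap (fun f : PathSpace p d => f t) inferInstance

/-- The back-shift `(B^h f)(t) = f (t - h)`. -/
def shift {p d : ℕ} (h : Fin p → ℝ) (f : PathSpace p d) : PathSpace p d :=
  ⟨fun t => f (t - h), by fun_prop⟩

/-- `H : C → [0, ∞]` belongs to `E_β`: it is measurable and `β`-homogeneous, that is,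
`H (c f) = c ^ β H f` for all `c > 0` and `f ∈ C`. -/
structure IsHomogeneousFunctional {p d : ℕ} (β : ℝ) (H : PathSpace p d → ℝ≥0∞) : Prop where
  measurable : Measurable H
  map_smul : ∀ (c : ℝ≥0) (f : PathSpace p d), 0 < c → H (c • f) = (c : ℝ≥0∞) ^ β * H f

/-- `‖f t‖`, for a norm `N` on `ℝᵈ`. -/
def normAt {p d : ℕ} (N : Seminorm ℝ (Fin d → ℝ)) (t : Fin p → ℝ) (f : PathSpace p d) : ℝ≥0 :=
  (N fun k => (f t k : ℝ)).toNNReal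

/-- The point of `ℝᵖ` with the given rational coordinates. -/
def ratPoint {p : ℕ} (q : Fin p → ℚ) : Fin p → ℝ := fun j => (q j : ℝ)

/-- The process `t ↦ max_{i ≥ 1} Γ_i^{-1/α} Z^{(i)}(t)`, realised on the product space of sequences
`(E_i)` and `(ω_i)`; here `Γ_i = E_1 + ⋯ + E_i` and `Z^{(i)} = Z(ω_i)`. The indices start at `0` in
the code, and the maximum is the supremum in `[0, ∞]`. -/
def deHaanSup {p d : ℕ} {Ω : Type*} (α : ℝ) (Z : Ω → PathSpace p d) (e : (ℕ → ℝ) × (ℕ → Ω)) :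
    (Fin p → ℝ) → Fin d → ℝ≥0∞ :=
  fun t k => ⨆ i : ℕ,
    ENNReal.ofReal ((∑ j ∈ Finset.range (i + 1), e.1 j) ^ (-1 / α)) * (Z (e.2 i) t k : ℝ≥0∞)

/-- The probability measure under which the `E_i` are i.i.d. unit exponential and the `ω_i` are
i.i.d. with law `P` and independent of the `E_i`; so the `Z(ω_i)` are independent copies of `Z`. -/
def deHaanMeasure {Ω : Type*} [MeasurableSpace Ω] (P : Measure Ω) [IsProbabilityMeasure P] :
    Measure ((ℕ → ℝ) × (ℕ → Ω)) :=
  haveI : IsProbabilityMeasure (expMeasure 1) := isProbabilityMeasure_expMeasure one_pos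
  (Measure.infinitePi fun _ : ℕ => expMeasure 1).prod (Measure.infinitePi fun _ : ℕ => P)

/-- `Z`, defined under `P`, is a spectral process of `X`, defined under `Q`: the process `X` has the
same law (on `[0, ∞]ᵈ`-valued functions with the product σ-field, so the same finite-dimensional
distributions) as `max_{i ≥ 1} Γ_i^{-1/α} Z^{(i)}`. -/
def IsSpectralProcess {p d : ℕ} {Ω Ω' : Type*} [MeasurableSpace Ω] [MeasurableSpace Ω'] (α : ℝ)
    (Z : Ω → PathSpace p d) (P : Measure Ω) [IsProbabilityMeasure P]
    (X : Ω' → PathSpace p d) (Q : Measure Ω') : Prop :=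
  Q.map (fun ω (t : Fin p → ℝ) (k : Fin d) => (X ω t k : ℝ≥0∞)) =
    (deHaanMeasure P).map (deHaanSup α Z)

/-- `B^h X` and `X` have the same law on `C`, for all `h`. -/
def IsStationary {p d : ℕ} {Ω : Type*} [MeasurableSpace Ω] (X : Ω → PathSpace p d)
    (Q : Measure Ω) : Prop :=
  ∀ h : Fin p → ℝ, Q.map (fun ω => shift h (X ω)) = Q.map X

/-- The law `A ↦ E[ρ(Z)^α 1(Z / ρ(Z) ∈ A)] / E[ρ(Z)^α]` on `C`. -/
def tiltedLaw {p d : ℕ} {Ω : Type*} [MeasurableSpace Ω] (α : ℝ) (ρ : PathSpace p d → ℝ≥0)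
    (Z : Ω → PathSpace p d) (P : Measure Ω) : Measure (PathSpace p d) :=
  (∫⁻ ω, (ρ (Z ω) : ℝ≥0∞) ^ α ∂P)⁻¹ •
    (P.withDensity fun ω => (ρ (Z ω) : ℝ≥0∞) ^ α).map fun ω => (ρ (Z ω))⁻¹ • Z ω

/-- The law of `Θ^{[h]}`: the law of `Z` tilted by `‖Z(h)‖`. -/
def thetaLaw {p d : ℕ} {Ω : Type*} [MeasurableSpace Ω] (α : ℝ) (N : Seminorm ℝ (Fin d → ℝ))
    (Z : Ω → PathSpace p d) (P : Measure Ω) (h : Fin p → ℝ) : Measure (PathSpace p d) :=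
  tiltedLaw α (normAt N h) Z P

open Classical in
/-- The law of `Θ^{[h,k]}`: the law of `Z` tilted by `Z_k(h)`, and the point mass at the constant
path `(1, …, 1)` if `E[Z_k(h)^α] = 0`. -/
def thetaCompLaw {p d : ℕ} {Ω : Type*} [MeasurableSpace Ω] (α : ℝ)
    (Z : Ω → PathSpace p d) (P : Measure Ω) (h : Fin p → ℝ) (k : Fin d) :
    Measure (PathSpace p d) :=
  if ∫⁻ ω, (Z ω h k : ℝ≥0∞) ^ α ∂P = 0 then
    Measure.dirac (ContinuousMap.const _ fun _ => 1)
  else tiltedLaw α (fun f => f h k) Z P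

/-- The process `Z_W(t) = Θ(t - W) / (∑_{s ∈ ℚᵖ} ‖Θ(s - W)‖^α P(W = s))^{1/α}`. -/
def shiftedNormalised {p d : ℕ} {S : Type*} [MeasurableSpace S] (α : ℝ)
    (N : Seminorm ℝ (Fin d → ℝ)) (Θ : S → PathSpace p d) (W : S → Fin p → ℚ) (R : Measure S)
    (ω : S) : PathSpace p d :=
  ((∑' s : Fin p → ℚ,
      (normAt N (ratPoint s - ratPoint (W ω)) (Θ ω) : ℝ≥0∞) ^ α * R (W ⁻¹' {s})) ^
        (1 / α))⁻¹.toNNReal •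
    shift (ratPoint (W ω)) (Θ ω)

end MaxStable

end

/-! ### An integral equation for the tail exponential. -/

namespace MaxStable
open Set Filter Topology

/-! Everything passes through the moments `E[(maxFun F Z)^α]`, where `maxFun F` is a finite
max-linear functional. The points `(Γ_i, Z^{(i)})` form a marked Poisson process, and `max_i
Γ_i^{-1/α} Z^{(i)}` lies in the box described by `F` exactly when every mark `(maxFun F Z^{(i)})^α`
is at most `Γ_i`. This void event has probability `exp (-E[(maxFun F Z)^α])`
(`deHaanMeasure_forall_le`). Boxes determine laws, so being a spectral process of `X` and
stationarity of `X` both become statements about these moments (`isSpectralProcess_iff`,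
`isStationary_iff_maxMoment`).

For (ii): a one-sided derivative of the moment in the weight at `(t, k)` is `E[Z_k(t)^α 1(maxFun F Z
≤ Z_k(t))]`, so the moments determine the law of `Z` tilted by `Z_k(t)`
(`tiltMeasure_eq_of_maxMoment_eq`); comparing `Z` with `B^h Z` gives the shift formula. Conversely,
an `α`-homogeneous functional controlled by finitely many coordinates splits into terms `Z_k(t)^α
Γ(Z)` with `Γ` of degree `0`, each of which the shift formula moves
(`HasShiftFormula.lintegral_shift`).

For (iii): the shift formula says that the unnormalised tilted measures are shifts of each other,
while (iii) says so only after normalisation. The missing point is that `E[Z_k(t)^α]` does not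
depend on `t`. Two evaluations of `E[Z_k(t)^α 1(Z_k(s) > 0)]` show that its ratio to the value at
`0` is multiplicative for suitable small increments; being bounded, it is `1`
(`HasThetaShift.hasShiftFormula`).

For (i): under the shift formula, mixing the shifts of `Θ` over `W` produces the weight `∑ ‖Z(s)‖^α
q(s)`, which the denominator of `Z_W` cancels, so `Z_W` has the moments of `Z`. Conversely, `Z_{W+q}
= B^q Z_W`, so `X` is invariant in law under rational shifts, and path continuity gives all shifts.
-/

lemma lintegral_expMeasure_one {f : ℝ → ℝ≥0∞} (hf : Measurable f) :
    ∫⁻ x, f x ∂(expMeasure 1) = ∫⁻ x in Ioi 0, ENNReal.ofReal (Real.exp (-x)) * f x := by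
  have h1 : expMeasure 1 = volume.withDensity (exponentialPDF 1) := rfl
  have h2 : Measurable (exponentialPDF 1) :=
    (measurable_exponentialPDFReal 1).ennreal_ofReal
  rw [h1, lintegral_withDensity_eq_lintegral_mul _ h2 hf,
    ← setLIntegral_congr (Ioi_ae_eq_Ici (a := (0 : ℝ))).symm, ← lintegral_indicator measurableSet_Ici]
  refine lintegral_congr fun x => ?_
  by_cases hx : 0 ≤ x
  · simp [indicator, hx, exponentialPDF_of_nonneg]
  · simp [indicator, hx, exponentialPDF_of_neg (not_le.1 hx)]

lemma antitone_tail_integral {m : ℝ → ℝ} (hm : Antitone m) (h0 : ∀ x, 0 ≤ m x)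
    (hint : IntegrableOn m (Ioi 0)) : Antitone fun x => ∫ u in Ioi x, m u := by
  have hi : ∀ x, IntegrableOn m (Ioi x) := fun x => by
    refine IntegrableOn.mono_set (t := Ioc x 0 ∪ Ioi 0) (IntegrableOn.union ?_ hint) ?_
    · exact (hm.intervalIntegrable (a := x) (b := 0)).1
    · intro y hy
      rcases le_or_gt y 0 with h | h
      · exact Or.inl ⟨hy, h⟩
      · exact Or.inr h
  intro a b hab
  exact setIntegral_mono_set (hi a) (Eventually.of_forall h0)
    (LE.le.eventuallyLE (Ioi_subset_Ioi hab))

/-- `G u = exp (-∫_u^∞ m)` solves `G s = E[(1 - m (s + E)) G (s + E)]` with `E` unit exponential. -/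
lemma lintegral_tail_exp_eq {m : ℝ → ℝ} (hm : Antitone m) (h0 : ∀ x, 0 ≤ m x) (h1 : ∀ x, m x ≤ 1)
    (hrc : ∀ x, ContinuousWithinAt m (Ioi x) x) (hint : IntegrableOn m (Ioi 0)) {s : ℝ}
    (hs : 0 ≤ s) :
    ∫⁻ x, ENNReal.ofReal ((1 - m (s + x)) * Real.exp (-∫ u in Ioi (s + x), m u)) ∂(expMeasure 1) =
      ENNReal.ofReal (Real.exp (-∫ u in Ioi s, m u)) := by
  have hmm : Measurable m := hm.measurable
  have hii : ∀ a b, IntervalIntegrable m volume a b := fun a b => hm.intervalIntegrable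
  have hints : IntegrableOn m (Ioi s) := hint.mono_set (Ioi_subset_Ioi hs)
  set K : ℝ → ℝ := fun x => ∫ u in s..(s + x), m u with hK
  set I : ℝ := ∫ u in Ioi s, m u with hI
  have hKI : ∀ x, 0 ≤ x → ∫ u in Ioi (s + x), m u = I - K x := by
    intro x hx
    have := intervalIntegral.integral_interval_add_Ioi hints
      (hints.mono_set (Ioi_subset_Ioi (show s ≤ s + x by linarith)))
    rw [hI, hK, ← this]; ring
  have hKcont : Continuous K :=
    (intervalIntegral.continuous_primitive hii s).comp (by fun_prop)
  -- `m` will be a survival function and may jump, so only right derivatives are available.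
  have hKder : ∀ x, HasDerivWithinAt K (m (s + x)) (Ioi x) x := by
    intro x
    have h := intervalIntegral.integral_hasDerivWithinAt_right (hii s (s + x)) (s := Ici (s + x))
      (t := Ioi (s + x)) hmm.stronglyMeasurable.stronglyMeasurableAtFilter (hrc (s + x))
    have h2 : HasDerivWithinAt (fun y : ℝ => s + y) 1 (Ioi x) x :=
      (hasDerivWithinAt_id x _).const_add s
    have := HasDerivWithinAt.scomp x h h2 (fun y hy => by
      simp only [mem_Ioi] at hy; simp only [mem_Ici]; linarith)
    simpa [hK, Function.comp_def] using this
  have hKle : ∀ x, 0 ≤ x → K x ≤ I := by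
    intro x hx
    have := hKI x hx
    have h3 : 0 ≤ ∫ u in Ioi (s + x), m u := integral_nonneg h0
    linarith
  -- On `x ≥ 0`, `exp (K x - I)` is `G (s + x)`. Hence `ψ` is the integrand including the
  -- exponential density, and `φ` is an antiderivative of it that vanishes at infinity and equals
  -- `-G s` at `0`.
  set φ : ℝ → ℝ := fun x => -(Real.exp (-x) * Real.exp (K x - I)) with hφ
  set ψ : ℝ → ℝ := fun x => Real.exp (-x) * ((1 - m (s + x)) * Real.exp (K x - I)) with hψ
  have hψm : Measurable ψ := by
    have := hKcont.measurable
    fun_prop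
  have hψ0 : ∀ x, 0 ≤ ψ x := fun x =>
    mul_nonneg (Real.exp_pos _).le (mul_nonneg (by linarith [h1 (s + x)]) (Real.exp_pos _).le)
  have hψle : ∀ x, 0 ≤ x → ψ x ≤ Real.exp (-x) := by
    intro x hx
    have e1 : Real.exp (K x - I) ≤ 1 := Real.exp_le_one_iff.2 (by linarith [hKle x hx])
    have e2 : (1 - m (s + x)) * Real.exp (K x - I) ≤ 1 :=
      mul_le_one₀ (by linarith [h0 (s + x)]) (Real.exp_pos _).le e1
    calc ψ x ≤ Real.exp (-x) * 1 := mul_le_mul_of_nonneg_left e2 (Real.exp_pos _).le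
      _ = _ := mul_one _
  have hψint : IntegrableOn ψ (Ioi 0) := by
    refine Integrable.mono' (integrableOn_exp_neg_Ioi 0) hψm.aestronglyMeasurable ?_
    filter_upwards [self_mem_ae_restrict measurableSet_Ioi] with x hx
    rw [Real.norm_of_nonneg (hψ0 x)]
    exact hψle x (le_of_lt hx)
  have hφder : ∀ x, HasDerivWithinAt φ (ψ x) (Ioi x) x := by
    intro x
    have e1 : HasDerivWithinAt (fun x : ℝ => Real.exp (-x)) (Real.exp (-x) * (-1)) (Ioi x) x :=
      ((hasDerivAt_neg x).exp).hasDerivWithinAt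
    have e2 : HasDerivWithinAt (fun x : ℝ => Real.exp (K x - I))
      (Real.exp (K x - I) * m (s + x)) (Ioi x) x := ((hKder x).sub_const I).exp
    refine (e1.mul e2).neg.congr_deriv ?_
    simp only [hψ]; ring
  have hφint : ∀ n : ℝ, 0 ≤ n → ∫ x in (0 : ℝ)..n, ψ x = φ n - φ 0 := by
    intro n hn
    refine intervalIntegral.integral_eq_sub_of_hasDeriv_right (by fun_prop)
      (fun x _ => hφder x) ?_
    rw [intervalIntegrable_iff_integrableOn_Ioc_of_le hn]
    exact hψint.mono_set Ioc_subset_Ioi_self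
  have hlim1 := intervalIntegral_tendsto_integral_Ioi 0 hψint tendsto_id
  have hφlim : Tendsto φ atTop (𝓝 0) := by
    have : Tendsto (fun x : ℝ => -Real.exp (-x)) atTop (𝓝 0) := by
      simpa using (Real.tendsto_exp_neg_atTop_nhds_zero).neg
    refine tendsto_of_tendsto_of_tendsto_of_le_of_le' this tendsto_const_nhds ?_ ?_
    · filter_upwards [eventually_ge_atTop 0] with x hx
      have e1 : Real.exp (K x - I) ≤ 1 := Real.exp_le_one_iff.2 (by linarith [hKle x hx])
      simp only [hφ]
      nlinarith [Real.exp_pos (-x)]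
    · filter_upwards with x
      simp only [hφ]
      have := mul_pos (Real.exp_pos (-x)) (Real.exp_pos (K x - I))
      linarith
  have hlim2 : Tendsto (fun n : ℝ => ∫ x in (0 : ℝ)..n, ψ x) atTop (𝓝 (0 - φ 0)) := by
    refine (hφlim.sub_const (φ 0)).congr' ?_
    filter_upwards [eventually_ge_atTop 0] with n hn
    exact (hφint n hn).symm
  have hval : ∫ x in Ioi 0, ψ x = Real.exp (-I) := by
    rw [tendsto_nhds_unique hlim1 hlim2]
    simp [hφ, hK]
  have hGm : Measurable fun x => ∫ u in Ioi x, m u := (antitone_tail_integral hm h0 hint).measurable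
  have hGm' : Measurable fun x =>
      ENNReal.ofReal ((1 - m (s + x)) * Real.exp (-∫ u in Ioi (s + x), m u)) := by
    have : Measurable fun x => ∫ u in Ioi (s + x), m u := hGm.comp (measurable_const_add s)
    fun_prop
  rw [lintegral_expMeasure_one hGm', ← hval,
    ofReal_integral_eq_lintegral_ofReal hψint (Eventually.of_forall hψ0)]
  refine setLIntegral_congr_fun measurableSet_Ioi fun x hx => ?_
  rw [hKI x (le_of_lt hx), ← ENNReal.ofReal_mul (Real.exp_pos _).le, neg_sub]

end MaxStable

/-! ### Renewal of the marked arrival sequence at its first point. -/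

namespace MaxStable
open Set Filter Topology

/-- The sequence with first term `q.1`, continued by `q.2`. -/
def consSeq {E : Type*} (q : E × (ℕ → E)) : ℕ → E
  | 0 => q.1
  | n + 1 => q.2 n

lemma measurable_consSeq {E : Type*} [MeasurableSpace E] :
    Measurable (consSeq : E × (ℕ → E) → ℕ → E) := by
  refine measurable_pi_lambda _ fun n => ?_
  cases n with
  | zero => exact measurable_fst
  | succ n => exact (measurable_pi_apply n).comp measurable_snd

lemma map_consSeq_infinitePi {E : Type*} [MeasurableSpace E] (μ : Measure E)
    [IsProbabilityMeasure μ] :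
    (μ.prod (Measure.infinitePi fun _ : ℕ => μ)).map consSeq =
      Measure.infinitePi fun _ : ℕ => μ := by
  classical
  refine Measure.eq_infinitePi _ fun s t ht => ?_
  obtain ⟨n, hn⟩ := s.exists_nat_subset_range
  have hsub : s ⊆ Finset.range (n + 1) :=
    hn.trans (Finset.range_subset_range.2 (Nat.le_succ n))
  -- Padding with `univ` turns the index set `s` into an initial segment, where the first factor can
  -- be split off.
  set t' : ℕ → Set E := fun i => if i ∈ s then t i else univ with ht'
  have htm : ∀ i, MeasurableSet (t' i) := fun i => by
    by_cases h : i ∈ s <;> simp [ht', h, ht i]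
  have e1 : ∏ i ∈ s, μ (t i) = ∏ i ∈ Finset.range (n + 1), μ (t' i) := by
    rw [← Finset.prod_subset hsub (f := fun i => μ (t' i)) (fun i _ hi => by simp [ht', hi])]
    exact Finset.prod_congr rfl fun i hi => by simp [ht', hi]
  have e2 : consSeq ⁻¹' (Set.pi (↑s) t) =
      t' 0 ×ˢ Set.pi (↑(Finset.range n)) fun i => t' (i + 1) := by
    ext q
    simp only [mem_preimage, Set.mem_pi, Finset.mem_coe, mem_prod, Finset.mem_range]
    constructor
    · intro h
      refine ⟨?_, fun i _ => ?_⟩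
      · by_cases h0 : 0 ∈ s
        · simpa [ht', h0, consSeq] using h 0 h0
        · simp [ht', h0]
      · by_cases h0 : i + 1 ∈ s
        · simpa [ht', h0, consSeq] using h (i + 1) h0
        · simp [ht', h0]
    · rintro ⟨h0, h⟩ i hi
      cases i with
      | zero => simpa [ht', hi, consSeq] using h0
      | succ i =>
        have := h i (by simpa using Nat.lt_of_succ_lt_succ (Finset.mem_range.1 (hsub hi)))
        simpa [ht', hi, consSeq] using this
  rw [Measure.map_apply measurable_consSeq (MeasurableSet.pi s.countable_toSet fun i _ => ht i), e2,
    Measure.prod_prod, Measure.infinitePi_pi _ (fun i _ => htm (i + 1)), e1,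
    Finset.prod_range_succ', mul_comm]

instance : IsProbabilityMeasure (expMeasure 1) := isProbabilityMeasure_expMeasure one_pos

variable {Ω : Type*} [MeasurableSpace Ω]

/-- The first `n` marks `v` lie below the arrival times shifted by `s`. -/
def belowArrivals (v : Ω → ℝ) (n : ℕ) (s : ℝ) : Set ((ℕ → ℝ) × (ℕ → Ω)) :=
  {e | ∀ i < n, v (e.2 i) ≤ s + ∑ j ∈ Finset.range (i + 1), e.1 j}

lemma measurableSet_belowArrivals {v : Ω → ℝ} (hv : Measurable v) (n : ℕ) (s : ℝ) :
    MeasurableSet (belowArrivals v n s) := by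
  have : belowArrivals v n s =
      ⋂ i, ⋂ (_ : i < n), {e | v (e.2 i) ≤ s + ∑ j ∈ Finset.range (i + 1), e.1 j} := by
    ext; simp [belowArrivals]
  rw [this]
  refine MeasurableSet.iInter fun i => MeasurableSet.iInter fun _ => measurableSet_le ?_ ?_
  · exact hv.comp ((measurable_pi_apply i).comp measurable_snd)
  · fun_prop

instance (P : Measure Ω) [IsProbabilityMeasure P] : IsProbabilityMeasure (deHaanMeasure P) := by
  unfold deHaanMeasure; infer_instance

/-- Condition on the first arrival `x` and its mark: the remaining points form an independent copy
of the whole sequence, with arrival times displaced by a further `x`. -/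
lemma deHaanMeasure_belowArrivals_succ (P : Measure Ω) [IsProbabilityMeasure P] {v : Ω → ℝ}
    (hv : Measurable v) (n : ℕ) (s : ℝ) :
    deHaanMeasure P (belowArrivals v (n + 1) s) =
      ∫⁻ x, P {ω | v ω ≤ s + x} * deHaanMeasure P (belowArrivals v n (s + x))
        ∂(expMeasure 1) := by
  have hmS := measurableSet_belowArrivals hv (n + 1) s
  have hmap : deHaanMeasure P = (((expMeasure 1).prod (Measure.infinitePi fun _ : ℕ =>
      expMeasure 1)).prod (P.prod (Measure.infinitePi fun _ : ℕ => P))).map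
        (Prod.map consSeq consSeq) := by
    rw [← Measure.map_prod_map _ _ measurable_consSeq measurable_consSeq,
      map_consSeq_infinitePi, map_consSeq_infinitePi]
    rfl
  have hiff : ∀ x (a : ℕ → ℝ) ω (y : ℕ → Ω),
      (consSeq (x, a), consSeq (ω, y)) ∈ belowArrivals v (n + 1) s ↔
        v ω ≤ s + x ∧ (a, y) ∈ belowArrivals v n (s + x) := by
    intro x a ω y
    simp only [belowArrivals, mem_ofPred_eq]
    constructor
    · intro h
      refine ⟨by simpa [consSeq] using h 0 (Nat.succ_pos n), fun i hi => ?_⟩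
      have := h (i + 1) (Nat.succ_lt_succ hi)
      rw [Finset.sum_range_succ'] at this
      simp only [consSeq] at this
      linarith
    · rintro ⟨h0, h⟩ i hi
      cases i with
      | zero => simpa [consSeq] using h0
      | succ i =>
        rw [Finset.sum_range_succ']
        simp only [consSeq]
        have := h i (Nat.lt_of_succ_lt_succ hi)
        linarith
  have hmT := (measurable_consSeq.prodMap measurable_consSeq) hmS
  rw [hmap, Measure.map_apply (measurable_consSeq.prodMap measurable_consSeq) hmS, ← hmap]
  rw [Measure.prod_apply hmT, lintegral_prod _ (measurable_measure_prodMk_left hmT).aemeasurable]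
  refine lintegral_congr fun x => ?_
  have e1 : ∀ a : ℕ → ℝ, Prod.mk (x, a) ⁻¹' (Prod.map consSeq consSeq ⁻¹'
      belowArrivals v (n + 1) s) =
      {ω | v ω ≤ s + x} ×ˢ (Prod.mk a ⁻¹' belowArrivals v n (s + x)) := by
    intro a
    ext ⟨ω, y⟩
    simpa using hiff x a ω y
  simp_rw [e1, Measure.prod_prod]
  rw [lintegral_const_mul _
    (measurable_measure_prodMk_left (measurableSet_belowArrivals hv n (s + x)))]
  congr 1
  unfold deHaanMeasure
  rw [Measure.prod_apply (measurableSet_belowArrivals hv n (s + x))]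

end MaxStable

/-! ### Void probabilities. -/

namespace MaxStable
open Set Filter Topology

/-- The factor `1 / 2` is the contraction that forces the iterates of the recursion to converge to
its solution. -/
lemma lintegral_expMeasure_exp_neg {c : ℝ} (hc : 0 ≤ c) :
    ∫⁻ x, ENNReal.ofReal (c * Real.exp (-x)) ∂(expMeasure 1) = ENNReal.ofReal (c / 2) := by
  have hi : IntegrableOn (fun x : ℝ => c * Real.exp (-2 * x)) (Ioi 0) :=
    (integrableOn_exp_mul_Ioi (by norm_num) 0).const_mul c
  rw [lintegral_expMeasure_one (by fun_prop)]
  have : ∀ x : ℝ, ENNReal.ofReal (Real.exp (-x)) * ENNReal.ofReal (c * Real.exp (-x)) =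
      ENNReal.ofReal (c * Real.exp (-2 * x)) := fun x => by
    rw [← ENNReal.ofReal_mul (Real.exp_pos _).le, show -2 * x = -x + -x by ring, Real.exp_add]
    congr 1; ring
  simp_rw [this]
  rw [← ofReal_integral_eq_lintegral_ofReal hi
    (Eventually.of_forall fun x => mul_nonneg hc (Real.exp_pos _).le),
    integral_const_mul, integral_exp_mul_Ioi (by norm_num)]
  congr 1
  simp; ring

lemma ae_expMeasure_pos : ∀ᵐ x ∂(expMeasure 1), 0 < x := by
  have hs : MeasurableSet (Iic (0 : ℝ)) := measurableSet_Iic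
  have hz : expMeasure 1 (Iic 0) = 0 := by
    rw [← lintegral_indicator_one hs, lintegral_expMeasure_one (measurable_one.indicator hs)]
    refine (setLIntegral_congr_fun (g := fun _ => 0) measurableSet_Ioi fun x hx => ?_).trans
      lintegral_zero
    simp [indicator, not_le.2 (mem_Ioi.1 hx)]
  filter_upwards [measure_eq_zero_iff_ae_notMem.1 hz] with x hx
  simpa using hx

variable {Ω : Type*} [MeasurableSpace Ω]

/-- Void probability of the marked Poisson process with points `(Γ_i, ω_i)`. -/
lemma deHaanMeasure_forall_le (P : Measure Ω) [IsProbabilityMeasure P] {v : Ω → ℝ}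
    (hv : Measurable v) (hv0 : ∀ ω, 0 ≤ v ω) (hvi : Integrable v P) :
    deHaanMeasure P {e | ∀ i, v (e.2 i) ≤ ∑ j ∈ Finset.range (i + 1), e.1 j} =
      ENNReal.ofReal (Real.exp (-∫ ω, v ω ∂P)) := by
  set m : ℝ → ℝ := fun x => P.real {ω | x < v ω} with hm
  have hms : ∀ x, MeasurableSet {ω | v ω ≤ x} := fun x => hv measurableSet_Iic
  have hmc : ∀ x, P.real {ω | v ω ≤ x} = 1 - m x := by
    intro x
    have := probReal_compl_eq_one_sub (μ := P) (hms x)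
    have hc : {ω | v ω ≤ x}ᶜ = {ω | x < v ω} := by ext; simp
    rw [hc] at this
    simp only [hm, this]; ring
  have hPm : ∀ x, P {ω | v ω ≤ x} = ENNReal.ofReal (1 - m x) := fun x => by
    rw [← hmc x, ofReal_measureReal]
  -- Right continuity of `m` is inherited from the distribution function.
  have hmcdf : m = fun x => 1 - cdf (P.map v) x := by
    have := Measure.isProbabilityMeasure_map (μ := P) hv.aemeasurable
    ext x
    rw [cdf_eq_real, map_measureReal_apply hv measurableSet_Iic]
    have : v ⁻¹' Iic x = {ω | v ω ≤ x} := rfl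
    rw [this, hmc]; ring
  have hanti : Antitone m := fun a b hab =>
    measureReal_mono (fun ω (h : b < v ω) => lt_of_le_of_lt hab h)
  have h0 : ∀ x, 0 ≤ m x := fun x => measureReal_nonneg
  have h1 : ∀ x, m x ≤ 1 := fun x => measureReal_le_one
  have hrc : ∀ x, ContinuousWithinAt m (Ioi x) x := by
    intro x
    rw [hmcdf]
    exact (continuousWithinAt_const.sub (((cdf (P.map v)).right_continuous x).mono
      Ioi_subset_Ici_self))
  have hint : IntegrableOn m (Ioi 0) := by
    refine ⟨hanti.measurable.aestronglyMeasurable, ?_⟩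
    rw [hasFiniteIntegral_iff_ofReal (Eventually.of_forall h0)]
    have hP : ∀ x, ENNReal.ofReal (m x) = P {ω | x < v ω} := fun x => ofReal_measureReal
    simp_rw [hP]
    rw [← lintegral_eq_lintegral_meas_lt P (Eventually.of_forall hv0) hv.aemeasurable]
    exact (hasFiniteIntegral_iff_ofReal (Eventually.of_forall hv0)).1 hvi.2
  have hI : ∫ ω, v ω ∂P = ∫ u in Ioi 0, m u :=
    hvi.integral_eq_integral_meas_lt (Eventually.of_forall hv0)
  set H : ℝ → ℝ := fun s => ∫ u in Ioi s, m u with hH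
  have hH0 : ∀ s, 0 ≤ H s := fun s => integral_nonneg h0
  have hHlim : Tendsto H atTop (𝓝 0) := by
    have h2 := (intervalIntegral_tendsto_integral_Ioi 0 hint tendsto_id).const_sub (H 0)
    rw [sub_self] at h2
    refine h2.congr' ?_
    filter_upwards [eventually_ge_atTop 0] with x hx
    have := intervalIntegral.integral_interval_add_Ioi hint
      (hint.mono_set (Ioi_subset_Ioi hx))
    simp only [hH, id, ← this]; ring
  have hHm : Measurable H := (antitone_tail_integral hanti h0 hint).measurable
  -- `exp (-H s)` is a fixed point of the recursion for the probabilities of `belowArrivals v n s`.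
  -- It bounds them from below by induction; from above, the `ε` error is not amplified, and the
  -- `exp (-s)` error is halved at every step.
  have hkey : ∀ ε > 0, ∃ C : ℝ, 0 ≤ C ∧ ∀ n : ℕ, ∀ s : ℝ, 0 ≤ s →
      ENNReal.ofReal (Real.exp (-H s)) ≤ deHaanMeasure P (belowArrivals v n s) ∧
      deHaanMeasure P (belowArrivals v n s) ≤ ENNReal.ofReal (Real.exp (-H s)) +
        (ENNReal.ofReal ε + ENNReal.ofReal (C / 2 ^ n * Real.exp (-s))) := by
    intro ε hε
    obtain ⟨T, hT⟩ := eventually_atTop.1 (hHlim.eventually (gt_mem_nhds hε))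
    -- With `C = exp T` the bound holds at `n = 0`: for `s ≥ T` the tail `H s` is below `ε`, and for
    -- `s < T` already `C exp (-s) ≥ 1`.
    refine ⟨Real.exp T, (Real.exp_pos _).le, fun n => ?_⟩
    induction n with
    | zero =>
      intro s hs
      have : belowArrivals v 0 s = univ := by ext; simp [belowArrivals]
      rw [this, measure_univ]
      refine ⟨ENNReal.ofReal_le_one.2 (Real.exp_le_one_iff.2 (by linarith [hH0 s])), ?_⟩
      rw [← ENNReal.ofReal_add hε.le (by positivity), ← ENNReal.ofReal_add (by positivity)
        (by positivity), ENNReal.one_le_ofReal, pow_zero, div_one, ← Real.exp_add]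
      rcases le_or_gt T s with h | h
      · have e1 := hT s h
        have e2 := Real.add_one_le_exp (-H s)
        have e3 := Real.exp_pos (T + -s)
        linarith
      · have e1 : 1 ≤ Real.exp (T + -s) := Real.one_le_exp (by linarith)
        have e2 := Real.exp_pos (-H s)
        linarith
    | succ n ih =>
      intro s hs
      rw [deHaanMeasure_belowArrivals_succ P hv]
      have hfix := lintegral_tail_exp_eq hanti h0 h1 hrc hint hs
      have hmeas : Measurable fun x => ENNReal.ofReal ((1 - m (s + x)) * Real.exp (-H (s + x))) := by
        have e1 : Measurable fun x => m (s + x) := hanti.measurable.comp (measurable_const_add s)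
        have e2 : Measurable fun x => H (s + x) := hHm.comp (measurable_const_add s)
        exact ((measurable_const.sub e1).mul e2.neg.exp).ennreal_ofReal
      have hm1 : ∀ x, 0 ≤ 1 - m x := fun x => by linarith [h1 x]
      constructor
      · rw [← hfix]
        refine lintegral_mono_ae ?_
        filter_upwards [ae_expMeasure_pos] with x hx
        rw [hPm, ENNReal.ofReal_mul (hm1 _)]
        gcongr
        exact (ih (s + x) (by linarith)).1
      · calc _ ≤ ∫⁻ x, (ENNReal.ofReal ((1 - m (s + x)) * Real.exp (-H (s + x))) +
              (ENNReal.ofReal ε +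
                ENNReal.ofReal (Real.exp T / 2 ^ n * Real.exp (-s) * Real.exp (-x))))
                ∂(expMeasure 1) := by
              refine lintegral_mono_ae ?_
              filter_upwards [ae_expMeasure_pos] with x hx
              refine (mul_le_mul_right (ih (s + x) (by linarith)).2 _).trans ?_
              rw [hPm, ENNReal.ofReal_mul (hm1 _), mul_add]
              gcongr
              refine (mul_le_of_le_one_left (zero_le) (ENNReal.ofReal_le_one.2
                (by linarith [h0 (s + x)]))).trans ?_
              rw [neg_add, Real.exp_add, mul_assoc]
          _ = _ := by
              rw [lintegral_add_left hmeas, hfix, lintegral_add_left measurable_const,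
                lintegral_const, measure_univ, mul_one, lintegral_expMeasure_exp_neg (by positivity),
                pow_succ]
              congr 4
              ring
  have hset : {e : (ℕ → ℝ) × (ℕ → Ω) | ∀ i, v (e.2 i) ≤ ∑ j ∈ Finset.range (i + 1), e.1 j} =
      ⋂ n, belowArrivals v n 0 := by
    ext e
    simp only [belowArrivals, zero_add, mem_iInter, mem_ofPred_eq]
    exact ⟨fun h n i _ => h i, fun h i => h (i + 1) i (Nat.lt_succ_self i)⟩
  have hlim : Tendsto (fun n => deHaanMeasure P (belowArrivals v n 0)) atTop
      (𝓝 (deHaanMeasure P (⋂ n, belowArrivals v n 0))) := by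
    refine tendsto_measure_iInter_atTop
      (fun n => (measurableSet_belowArrivals hv n 0).nullMeasurableSet) ?_ ⟨0, measure_ne_top _ _⟩
    exact fun a b hab e he i hi => he i (lt_of_lt_of_le hi hab)
  rw [hset, hI]
  refine le_antisymm ?_ (ge_of_tendsto' hlim fun n => ?_)
  · refine ENNReal.le_of_forall_pos_le_add fun ε hε _ => ?_
    obtain ⟨C, hC, h⟩ := hkey ε hε
    have hlim2 : Tendsto (fun n : ℕ => ENNReal.ofReal (Real.exp (-H 0)) +
        (ENNReal.ofReal ε + ENNReal.ofReal (C / 2 ^ n * Real.exp (-0)))) atTop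
        (𝓝 (ENNReal.ofReal (Real.exp (-H 0)) + (ENNReal.ofReal ε + ENNReal.ofReal 0))) := by
      refine tendsto_const_nhds.add (tendsto_const_nhds.add (ENNReal.tendsto_ofReal ?_))
      have : Tendsto (fun n : ℕ => C * (1 / 2 : ℝ) ^ n * Real.exp (-0)) atTop
          (𝓝 (C * 0 * Real.exp (-0))) :=
        ((tendsto_pow_atTop_nhds_zero_of_lt_one (by norm_num) (by norm_num)).const_mul C).mul_const _
      simpa [div_eq_mul_inv] using this
    have := le_of_tendsto_of_tendsto' hlim hlim2 fun n => (h n 0 le_rfl).2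
    simpa using this
  · obtain ⟨C, hC, h⟩ := hkey 1 one_pos
    exact (h n 0 le_rfl).1

end MaxStable

/-! ### Boxes determine laws; max-linear functionals on the path space. -/

namespace MaxStable
open Set Filter Topology

/-- Finite measures agreeing on the finite boxes `{∀ a ∈ F, a.2 * g a.1 ≤ 1}` are equal, if the
functions `g i` generate the σ-field. -/
lemma ext_of_forall_box {E I : Type*} [mE : MeasurableSpace E] (g : I → E → ℝ≥0∞)
    (hg : mE = ⨆ i, MeasurableSpace.comap (g i) inferInstance) (μ ν : Measure E)
    [IsFiniteMeasure μ]
    (h : ∀ F : Finset (I × ℝ≥0), μ {e | ∀ a ∈ F, (a.2 : ℝ≥0∞) * g a.1 e ≤ 1} =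
      ν {e | ∀ a ∈ F, (a.2 : ℝ≥0∞) * g a.1 e ≤ 1}) : μ = ν := by
  classical
  set C : Set (Set E) := range fun F : Finset (I × ℝ≥0) =>
    {e | ∀ a ∈ F, (a.2 : ℝ≥0∞) * g a.1 e ≤ 1} with hC
  have hgm : ∀ i, Measurable (g i) := fun i => by
    rw [measurable_iff_comap_le]
    conv_rhs => rw [hg]
    exact le_iSup (fun i => MeasurableSpace.comap (g i) _) i
  refine ext_of_generate_finite C ?_ ?_ ?_ ?_
  · refine le_antisymm ?_ (MeasurableSpace.generateFrom_le ?_)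
    · conv_lhs => rw [hg]
      refine iSup_le fun i => ?_
      rw [← measurable_iff_comap_le]
      refine measurable_of_Iic (mδ := MeasurableSpace.generateFrom C) fun c => ?_
      rcases eq_or_ne c ∞ with rfl | hc
      · simp
      lift c to ℝ≥0 using hc
      -- A box bounds `g i` by the inverse of a weight, so the level `c = 0` is reached only as a
      -- limit of positive levels.
      have hpos : ∀ n : ℕ, 0 < c + 1 / ((n : ℝ≥0) + 1) := fun n => by positivity
      have : g i ⁻¹' Iic (c : ℝ≥0∞) = ⋂ n : ℕ, {e | ∀ a ∈ ({(i, (c + 1 / ((n : ℝ≥0) + 1))⁻¹)} :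
          Finset (I × ℝ≥0)), (a.2 : ℝ≥0∞) * g a.1 e ≤ 1} := by
        ext e
        simp only [mem_preimage, mem_Iic, Finset.mem_singleton, forall_eq, mem_iInter, mem_ofPred_eq]
        have hiff : ∀ n : ℕ, (((c + 1 / ((n : ℝ≥0) + 1))⁻¹ : ℝ≥0) : ℝ≥0∞) * g i e ≤ 1 ↔
            g i e ≤ ((c + 1 / ((n : ℝ≥0) + 1) : ℝ≥0) : ℝ≥0∞) := fun n => by
          rw [ENNReal.coe_inv (hpos n).ne', mul_comm, ← div_eq_mul_inv,
            ENNReal.div_le_iff (by simp) ENNReal.coe_ne_top, one_mul]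
        simp_rw [hiff]
        constructor
        · intro h n
          refine h.trans ?_
          exact_mod_cast le_self_add
        · intro h
          have hl : Tendsto (fun n : ℕ => ((c + 1 / ((n : ℝ≥0) + 1) : ℝ≥0) : ℝ≥0∞)) atTop
              (𝓝 ((c + 0 : ℝ≥0) : ℝ≥0∞)) := by
            refine ENNReal.tendsto_coe.2 (tendsto_const_nhds.add ?_)
            exact tendsto_one_div_add_atTop_nhds_zero_nat
          rw [add_zero] at hl
          exact ge_of_tendsto' hl h
      rw [this]
      exact MeasurableSet.iInter fun n => MeasurableSpace.measurableSet_generateFrom ⟨_, rfl⟩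
    · rintro _ ⟨F, rfl⟩
      have : {e | ∀ a ∈ F, (a.2 : ℝ≥0∞) * g a.1 e ≤ 1} =
          ⋂ a, ⋂ (_ : a ∈ F), {e | (a.2 : ℝ≥0∞) * g a.1 e ≤ 1} := by ext; simp
      simp only [this]
      exact Finset.measurableSet_biInter F fun a _ =>
        measurableSet_le ((hgm a.1).const_mul _) measurable_const
  · rintro _ ⟨F, rfl⟩ _ ⟨F', rfl⟩ -
    refine ⟨F ∪ F', ?_⟩
    ext e
    simp only [Finset.mem_union, mem_ofPred_eq, mem_inter_iff]
    exact ⟨fun h => ⟨fun a ha => h a (Or.inl ha), fun a ha => h a (Or.inr ha)⟩,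
      fun h a ha => ha.elim (h.1 a) (h.2 a)⟩
  · rintro _ ⟨F, rfl⟩
    exact h F
  -- The empty family gives equality of the total masses.
  · simpa using h ∅

variable {p d : ℕ}

lemma measurable_eval (t : Fin p → ℝ) : Measurable fun f : PathSpace p d => f t := by
  rw [measurable_iff_comap_le]
  exact le_iSup (fun t : Fin p → ℝ =>
    MeasurableSpace.comap (fun f : PathSpace p d => f t) inferInstance) t

lemma measurable_eval_apply (t : Fin p → ℝ) (k : Fin d) :
    Measurable fun f : PathSpace p d => f t k :=
  (measurable_pi_apply k).comp (measurable_eval t)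

lemma measurable_of_eval {β : Type*} [MeasurableSpace β] {g : β → PathSpace p d}
    (hg : ∀ t k, Measurable fun x => g x t k) : Measurable g := by
  rw [measurable_iff_comap_le, instMeasurableSpacePathSpace, MeasurableSpace.comap_iSup]
  refine iSup_le fun t => ?_
  rw [MeasurableSpace.comap_comp, ← measurable_iff_comap_le]
  exact measurable_pi_lambda _ fun k => hg t k

lemma pathSpace_measurableSpace_eq : instMeasurableSpacePathSpace p d =
    ⨆ i : (Fin p → ℝ) × Fin d,
      MeasurableSpace.comap (fun f : PathSpace p d => (f i.1 i.2 : ℝ≥0∞)) inferInstance := by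
  refine le_antisymm ?_ (iSup_le fun i => ?_)
  · refine iSup_le fun t => ?_
    rw [← measurable_iff_comap_le]
    refine @measurable_pi_lambda _ _ _ (_) _ _ fun k => ?_
    have : @Measurable _ _ (⨆ i : (Fin p → ℝ) × Fin d,
      MeasurableSpace.comap (fun f : PathSpace p d => (f i.1 i.2 : ℝ≥0∞)) inferInstance) _
        fun f : PathSpace p d => (f t k : ℝ≥0∞) := by
      rw [measurable_iff_comap_le]
      exact le_iSup (fun i : (Fin p → ℝ) × Fin d => MeasurableSpace.comap
        (fun f : PathSpace p d => (f i.1 i.2 : ℝ≥0∞)) inferInstance) (t, k)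
    simpa using this.ennreal_toNNReal
  · rw [← measurable_iff_comap_le]
    exact (measurable_eval_apply i.1 i.2).coe_nnreal_ennreal

@[simp] lemma shift_apply (h : Fin p → ℝ) (f : PathSpace p d) (t : Fin p → ℝ) :
    shift h f t = f (t - h) := rfl

lemma shift_shift (h h' : Fin p → ℝ) (f : PathSpace p d) :
    shift h (shift h' f) = shift (h + h') f := by
  ext t k
  simp [sub_sub]

lemma shift_smul (h : Fin p → ℝ) (c : ℝ≥0) (f : PathSpace p d) :
    shift h (c • f) = c • shift h f := rfl

lemma measurable_shift (h : Fin p → ℝ) : Measurable (shift (d := d) h) :=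
  measurable_of_eval fun t k => measurable_eval_apply (t - h) k

lemma measurable_smul_path {β : Type*} [MeasurableSpace β] {c : β → ℝ≥0} {g : β → PathSpace p d}
    (hc : Measurable c) (hg : Measurable g) : Measurable fun x => c x • g x :=
  measurable_of_eval fun t k => by
    have := (measurable_eval_apply t k).comp hg
    exact hc.mul this

/-- The max-linear functional `f ↦ max_{(t, k, y) ∈ F} y f_k(t)`. -/
noncomputable def maxFun (F : Finset (((Fin p → ℝ) × Fin d) × ℝ≥0)) (f : PathSpace p d) : ℝ≥0 :=
  F.sup fun a => a.2 * f a.1.1 a.1.2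

variable (F : Finset (((Fin p → ℝ) × Fin d) × ℝ≥0))

lemma measurable_maxFun : Measurable (maxFun F) := by
  classical
  unfold maxFun
  induction F using Finset.induction_on with
  | empty => simp
  | insert a F _ ih =>
    simp only [Finset.sup_insert]
    exact ((measurable_eval_apply _ _).const_mul _).sup ih

variable {F} in
lemma maxFun_le_iff {f : PathSpace p d} {c : ℝ≥0} :
    maxFun F f ≤ c ↔ ∀ a ∈ F, a.2 * f a.1.1 a.1.2 ≤ c := by
  simp [maxFun]

lemma maxFun_smul (c : ℝ≥0) (f : PathSpace p d) : maxFun F (c • f) = c * maxFun F f := by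
  simp only [maxFun, NNReal.mul_finset_sup]
  refine Finset.sup_congr rfl fun a _ => ?_
  simp; ring

/-- The test family of `f ↦ maxFun F (shift h f)`. -/
noncomputable def shiftFamily (h : Fin p → ℝ) : Finset (((Fin p → ℝ) × Fin d) × ℝ≥0) :=
  by classical exact F.image fun a => ((a.1.1 - h, a.1.2), a.2)

lemma maxFun_shiftFamily (h : Fin p → ℝ) (f : PathSpace p d) :
    maxFun (shiftFamily F h) f = maxFun F (shift h f) := by
  classical
  simp only [maxFun, shiftFamily, Finset.sup_image]
  rfl

/-- The family `F` with the value at `(t, k)` added with weight `c`. -/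
noncomputable def insertFamily (t : Fin p → ℝ) (k : Fin d) (c : ℝ≥0) :
    Finset (((Fin p → ℝ) × Fin d) × ℝ≥0) :=
  by classical exact insert ((t, k), c) F

lemma maxFun_insertFamily (t : Fin p → ℝ) (k : Fin d) (c : ℝ≥0) (f : PathSpace p d) :
    maxFun (insertFamily F t k c) f = max (c * f t k) (maxFun F f) := by
  classical
  simp [maxFun, insertFamily, Finset.sup_insert]

/-- Finite measures on `C` agreeing on the sets `{maxFun F ≤ 1}` are equal. -/
lemma ext_of_forall_maxFun (μ ν : Measure (PathSpace p d)) [IsFiniteMeasure μ]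
    (h : ∀ F, μ {f | maxFun F f ≤ 1} = ν {f | maxFun F f ≤ 1}) : μ = ν := by
  refine ext_of_forall_box (fun i : (Fin p → ℝ) × Fin d => fun f : PathSpace p d =>
    (f i.1 i.2 : ℝ≥0∞)) pathSpace_measurableSpace_eq μ ν fun F => ?_
  have : {e : PathSpace p d | ∀ a ∈ F, (a.2 : ℝ≥0∞) * (e a.1.1 a.1.2 : ℝ≥0∞) ≤ 1} =
      {f | maxFun F f ≤ 1} := by
    ext f
    simp only [mem_ofPred_eq, maxFun_le_iff]
    exact forall₂_congr fun a _ => by exact_mod_cast Iff.rfl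
  rw [this, h F]

/-! ### The norm of a path at a point. -/

section Norm

variable (N : Seminorm ℝ (Fin d → ℝ))

lemma seminorm_continuous : Continuous N :=
  continuousOn_univ.1 (N.convexOn.continuousOn isOpen_univ)

lemma measurable_normAt (t : Fin p → ℝ) : Measurable (normAt (p := p) N t) := by
  unfold normAt
  refine Measurable.real_toNNReal ((seminorm_continuous N).measurable.comp ?_)
  exact measurable_pi_lambda _ fun k => (measurable_eval_apply t k).coe_nnreal_real

lemma continuous_normAt (f : PathSpace p d) : Continuous fun t => normAt N t f := by
  unfold normAt
  refine continuous_real_toNNReal.comp ((seminorm_continuous N).comp ?_)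
  fun_prop

lemma normAt_smul (t : Fin p → ℝ) (c : ℝ≥0) (f : PathSpace p d) :
    normAt N t (c • f) = c * normAt N t f := by
  unfold normAt
  have : (fun k => (((c • f) t k : ℝ≥0) : ℝ)) = (c : ℝ) • fun k => (f t k : ℝ) := by
    ext k; simp
  rw [this, map_smul_eq_mul, Real.toNNReal_mul (norm_nonneg _)]
  simp

lemma normAt_shift (t h : Fin p → ℝ) (f : PathSpace p d) :
    normAt N t (shift h f) = normAt N (t - h) f := rfl

/-- Norms on `ℝᵈ` are equivalent: the constant is the inverse of the minimum of `N` on the unit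
sphere of the sup norm. An empty sphere means that there is no non-zero vector. -/
lemma exists_apply_le_normAt (hN : ∀ x, N x = 0 → x = 0) :
    ∃ C : ℝ≥0, ∀ (t : Fin p → ℝ) (k : Fin d) (f : PathSpace p d), f t k ≤ C * normAt N t f := by
  have key : ∃ C : ℝ≥0, ∀ x : Fin d → ℝ, ‖x‖ ≤ C * N x := by
    rcases (Metric.sphere (0 : Fin d → ℝ) 1).eq_empty_or_nonempty with he | hne
    · refine ⟨0, fun x => ?_⟩
      by_cases hx : x = 0
      · simp [hx]
      · have : ‖x‖⁻¹ • x ∈ Metric.sphere (0 : Fin d → ℝ) 1 := by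
          simp [norm_smul, norm_ne_zero_iff.2 hx]
        simp [he] at this
    · obtain ⟨x₀, hx₀, hmin⟩ := (isCompact_sphere (0 : Fin d → ℝ) 1).exists_isMinOn hne
        (seminorm_continuous N).continuousOn
      have hpos : 0 < N x₀ := lt_of_le_of_ne (apply_nonneg N x₀) fun h => by
        have := hN x₀ h.symm
        simp [this] at hx₀
      refine ⟨(N x₀)⁻¹.toNNReal, fun x => ?_⟩
      rw [Real.coe_toNNReal _ (inv_nonneg.2 hpos.le)]
      by_cases hx : x = 0
      · simp [hx]
      · have hx' := norm_pos_iff.2 hx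
        have hm : ‖x‖⁻¹ • x ∈ Metric.sphere (0 : Fin d → ℝ) 1 := by
          simp [norm_smul, norm_ne_zero_iff.2 hx]
        have := hmin hm
        simp only [mem_ofPred_eq, map_smul_eq_mul, norm_inv, norm_norm] at this
        rw [inv_mul_eq_div, le_div_iff₀ hx'] at this
        rw [inv_mul_eq_div, le_div_iff₀ hpos]
        linarith
  obtain ⟨C, hC⟩ := key
  refine ⟨C, fun t k f => ?_⟩
  rw [← NNReal.coe_le_coe, NNReal.coe_mul, normAt, Real.coe_toNNReal _ (apply_nonneg N _)]
  refine le_trans ?_ (hC _)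
  have := norm_le_pi_norm (fun k => (f t k : ℝ)) k
  simpa using this

end Norm

end MaxStable

/-! ### Spectral processes and stationarity in terms of moments. -/

namespace MaxStable
open Set Filter Topology

variable {p d : ℕ} {Ω : Type*} [MeasurableSpace Ω]

/-- `E[(maxFun F Z)^α]`. -/
noncomputable def maxMoment (α : ℝ) (Z : Ω → PathSpace p d) (P : Measure Ω)
    (F : Finset (((Fin p → ℝ) × Fin d) × ℝ≥0)) : ℝ≥0∞ :=
  ∫⁻ ω, (maxFun F (Z ω) : ℝ≥0∞) ^ α ∂P

lemma measurable_apply {Z : Ω → PathSpace p d} (hZ : Measurable Z) (t : Fin p → ℝ) (k : Fin d) :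
    Measurable fun ω => Z ω t k :=
  (measurable_eval_apply t k).comp hZ

lemma maxFun_rpow_le_sum {α : ℝ} (hα : 0 < α) (F : Finset (((Fin p → ℝ) × Fin d) × ℝ≥0))
    (f : PathSpace p d) :
    (maxFun F f : ℝ≥0∞) ^ α ≤ ∑ a ∈ F, (a.2 : ℝ≥0∞) ^ α * (f a.1.1 a.1.2 : ℝ≥0∞) ^ α := by
  classical
  unfold maxFun
  induction F using Finset.induction_on with
  | empty => simp [hα]
  | insert a F ha ih =>
    rw [Finset.sup_insert, Finset.sum_insert ha, ← ENNReal.mul_rpow_of_nonneg _ _ hα.le]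
    rcases le_total (a.2 * f a.1.1 a.1.2) (F.sup fun a => a.2 * f a.1.1 a.1.2) with h | h
    · rw [sup_eq_right.2 h]
      exact ih.trans le_add_self
    · rw [sup_eq_left.2 h, ENNReal.coe_mul]
      exact le_self_add

lemma maxMoment_ne_top {α : ℝ} (hα : 0 < α) {Z : Ω → PathSpace p d} (hZ : Measurable Z)
    {P : Measure Ω} (hfin : ∀ t k, ∫⁻ ω, (Z ω t k : ℝ≥0∞) ^ α ∂P ≠ ∞)
    (F : Finset (((Fin p → ℝ) × Fin d) × ℝ≥0)) : maxMoment α Z P F ≠ ∞ := by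
  refine ne_top_of_le_ne_top ?_ (lintegral_mono fun ω => maxFun_rpow_le_sum hα F (Z ω))
  have hm : ∀ t k, Measurable fun ω => (Z ω t k : ℝ≥0∞) ^ α := fun t k =>
    (measurable_apply hZ t k).coe_nnreal_ennreal.pow_const α
  rw [lintegral_finsetSum _ fun a _ => (hm _ _).const_mul _]
  refine ENNReal.sum_ne_top.2 fun a _ => ?_
  rw [lintegral_const_mul _ (hm _ _)]
  exact ENNReal.mul_ne_top (ENNReal.rpow_ne_top_of_nonneg hα.le ENNReal.coe_ne_top) (hfin _ _)

lemma measurable_deHaanSup (α : ℝ) {Z : Ω → PathSpace p d} (hZ : Measurable Z) :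
    Measurable (deHaanSup α Z) := by
  refine measurable_pi_lambda _ fun t => measurable_pi_lambda _ fun k => ?_
  refine Measurable.iSup fun i => ?_
  have h1 : Measurable fun e : (ℕ → ℝ) × (ℕ → Ω) => (Z (e.2 i) t k : ℝ≥0∞) :=
    ((measurable_apply hZ t k).comp
      ((measurable_pi_apply i).comp measurable_snd)).coe_nnreal_ennreal
  fun_prop

lemma ae_deHaanMeasure_arrival_pos (P : Measure Ω) [IsProbabilityMeasure P] :
    ∀ᵐ e ∂(deHaanMeasure P), ∀ i, 0 < ∑ j ∈ Finset.range (i + 1), e.1 j := by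
  have h1 : ∀ᵐ e ∂(deHaanMeasure P), ∀ j, 0 < e.1 j := by
    refine ae_all_iff.2 fun j => ?_
    have hq : Measure.QuasiMeasurePreserving (fun e : (ℕ → ℝ) × (ℕ → Ω) => e.1 j)
        (deHaanMeasure P) (expMeasure 1) := by
      have := (measurePreserving_eval_infinitePi (fun _ : ℕ => expMeasure 1) j).comp
        (measurePreserving_fst (μ := Measure.infinitePi fun _ : ℕ => expMeasure 1)
          (ν := Measure.infinitePi fun _ : ℕ => P))
      exact this.quasiMeasurePreserving
    exact hq.ae ae_expMeasure_pos
  filter_upwards [h1] with e he i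
  exact Finset.sum_pos (fun j _ => he j) ⟨0, by simp⟩

/-- For `Γ_i > 0`, `Γ_i^{-1/α} maxFun F Z^{(i)} ≤ 1` means `(maxFun F Z^{(i)})^α ≤ Γ_i`, so the box
is a void event with marks `(maxFun F Z)^α`. -/
lemma deHaanMeasure_box {α : ℝ} (hα : 0 < α) {Z : Ω → PathSpace p d} (hZ : Measurable Z)
    (P : Measure Ω) [IsProbabilityMeasure P] (F : Finset (((Fin p → ℝ) × Fin d) × ℝ≥0))
    (hF : maxMoment α Z P F ≠ ∞) :
    deHaanMeasure P {e | ∀ a ∈ F, (a.2 : ℝ≥0∞) * deHaanSup α Z e a.1.1 a.1.2 ≤ 1} =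
      ENNReal.ofReal (Real.exp (-(maxMoment α Z P F).toReal)) := by
  set v : Ω → ℝ := fun ω => ((maxFun F (Z ω) ^ α : ℝ≥0) : ℝ) with hv
  have hvm : Measurable v :=
    (((measurable_maxFun F).comp hZ).pow_const α).coe_nnreal_real
  have hv0 : ∀ ω, 0 ≤ v ω := fun ω => NNReal.coe_nonneg _
  have hlv : ∫⁻ ω, ENNReal.ofReal (v ω) ∂P = maxMoment α Z P F := by
    refine lintegral_congr fun ω => ?_
    simp only [hv, ENNReal.ofReal_coe_nnreal]
    rw [ENNReal.coe_rpow_of_nonneg _ hα.le]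
  have hvi : Integrable v P := by
    refine ⟨hvm.aestronglyMeasurable, ?_⟩
    rw [hasFiniteIntegral_iff_ofReal (Eventually.of_forall hv0), hlv]
    exact hF.lt_top
  have hint : ∫ ω, v ω ∂P = (maxMoment α Z P F).toReal := by
    rw [integral_eq_lintegral_of_nonneg_ae (Eventually.of_forall hv0) hvm.aestronglyMeasurable, hlv]
  rw [← hint, ← deHaanMeasure_forall_le P hvm hv0 hvi]
  refine measure_congr ?_
  -- Positivity of the arrival times is needed to invert the real power.
  filter_upwards [ae_deHaanMeasure_arrival_pos P] with e he
  refine propext ?_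
  change (∀ a ∈ F, (a.2 : ℝ≥0∞) * deHaanSup α Z e a.1.1 a.1.2 ≤ 1) ↔
    ∀ i, v (e.2 i) ≤ ∑ j ∈ Finset.range (i + 1), e.1 j
  simp only [deHaanSup, ENNReal.mul_iSup, iSup_le_iff]
  refine Iff.trans ⟨fun h i a ha => h a ha i, fun h a ha i => h i a ha⟩ (forall_congr' fun i => ?_)
  set γ := ∑ j ∈ Finset.range (i + 1), e.1 j with hγ
  have hγ0 : 0 < γ := he i
  set c : ℝ≥0 := (γ ^ (-1 / α)).toNNReal with hc
  have hstep : (∀ a ∈ F, (a.2 : ℝ≥0∞) * (ENNReal.ofReal (γ ^ (-1 / α)) *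
      (Z (e.2 i) a.1.1 a.1.2 : ℝ≥0∞)) ≤ 1) ↔ maxFun F (c • Z (e.2 i)) ≤ 1 := by
    rw [maxFun_le_iff]
    refine forall₂_congr fun a _ => ?_
    have : ENNReal.ofReal (γ ^ (-1 / α)) = (c : ℝ≥0∞) := rfl
    rw [this]
    exact_mod_cast Iff.rfl
  rw [hstep, maxFun_smul, ← NNReal.coe_le_coe, NNReal.coe_mul, hc,
    Real.coe_toNNReal _ (Real.rpow_nonneg hγ0.le _), neg_div, Real.rpow_neg hγ0.le, one_div,
    NNReal.coe_one, inv_mul_le_iff₀ (Real.rpow_pos_of_pos hγ0 _), mul_one,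
    Real.le_rpow_inv_iff_of_pos (NNReal.coe_nonneg _) hγ0.le hα]
  simp [hv]

lemma pi_measurableSpace_eq {I J : Type*} :
    (inferInstance : MeasurableSpace (I → J → ℝ≥0∞)) =
      ⨆ i : I × J, MeasurableSpace.comap (fun e : I → J → ℝ≥0∞ => e i.1 i.2) inferInstance := by
  refine le_antisymm ?_ (iSup_le fun i => ?_)
  · refine iSup_le fun t => ?_
    rw [← measurable_iff_comap_le]
    refine @measurable_pi_lambda _ _ _ (_) _ _ fun k => ?_
    rw [measurable_iff_comap_le]
    exact le_iSup (fun i : I × J => MeasurableSpace.comap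
      (fun e : I → J → ℝ≥0∞ => e i.1 i.2) inferInstance) (t, k)
  · rw [← measurable_iff_comap_le]
    fun_prop

variable {Ω' : Type*} [MeasurableSpace Ω']

lemma measurable_coe_path {X : Ω' → PathSpace p d} (hX : Measurable X) :
    Measurable fun ω (t : Fin p → ℝ) (k : Fin d) => (X ω t k : ℝ≥0∞) :=
  measurable_pi_lambda _ fun t => measurable_pi_lambda _ fun k =>
    (measurable_apply hX t k).coe_nnreal_ennreal

lemma measurableSet_box (F : Finset (((Fin p → ℝ) × Fin d) × ℝ≥0)) : MeasurableSet
    {e : (Fin p → ℝ) → Fin d → ℝ≥0∞ | ∀ a ∈ F, (a.2 : ℝ≥0∞) * e a.1.1 a.1.2 ≤ 1} := by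
  have : {e : (Fin p → ℝ) → Fin d → ℝ≥0∞ | ∀ a ∈ F, (a.2 : ℝ≥0∞) * e a.1.1 a.1.2 ≤ 1} =
      ⋂ a, ⋂ (_ : a ∈ F), {e | (a.2 : ℝ≥0∞) * e a.1.1 a.1.2 ≤ 1} := by ext; simp
  rw [this]
  exact Finset.measurableSet_biInter F fun a _ => measurableSet_le (by fun_prop) measurable_const

lemma map_coe_path_box {X : Ω' → PathSpace p d} (hX : Measurable X) (Q : Measure Ω')
    (F : Finset (((Fin p → ℝ) × Fin d) × ℝ≥0)) :
    Q.map (fun ω (t : Fin p → ℝ) (k : Fin d) => (X ω t k : ℝ≥0∞))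
      {e | ∀ a ∈ F, (a.2 : ℝ≥0∞) * e a.1.1 a.1.2 ≤ 1} = Q {ω | maxFun F (X ω) ≤ 1} := by
  rw [Measure.map_apply (measurable_coe_path hX) (measurableSet_box F)]
  congr 1
  ext ω
  simp only [mem_preimage, mem_ofPred_eq, maxFun_le_iff]
  exact forall₂_congr fun a _ => by exact_mod_cast Iff.rfl

lemma isSpectralProcess_iff {α : ℝ} (hα : 0 < α) {Z : Ω → PathSpace p d} (hZ : Measurable Z)
    {P : Measure Ω} [IsProbabilityMeasure P] {X : Ω' → PathSpace p d} (hX : Measurable X)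
    {Q : Measure Ω'} [IsProbabilityMeasure Q] (hfin : ∀ F, maxMoment α Z P F ≠ ∞) :
    IsSpectralProcess α Z P X Q ↔ ∀ F, Q {ω | maxFun F (X ω) ≤ 1} =
      ENNReal.ofReal (Real.exp (-(maxMoment α Z P F).toReal)) := by
  have e2 : ∀ F, (deHaanMeasure P).map (deHaanSup α Z)
      {e | ∀ a ∈ F, (a.2 : ℝ≥0∞) * e a.1.1 a.1.2 ≤ 1} =
        ENNReal.ofReal (Real.exp (-(maxMoment α Z P F).toReal)) := by
    intro F
    rw [Measure.map_apply (measurable_deHaanSup α hZ) (measurableSet_box F),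
      ← deHaanMeasure_box hα hZ P F (hfin F)]
    rfl
  constructor
  · intro h F
    rw [← map_coe_path_box hX, ← e2, show Q.map _ = (deHaanMeasure P).map (deHaanSup α Z) from h]
  · intro h
    have := Measure.isProbabilityMeasure_map (μ := Q) (measurable_coe_path hX).aemeasurable
    refine ext_of_forall_box (fun (i : (Fin p → ℝ) × Fin d) (e : (Fin p → ℝ) → Fin d → ℝ≥0∞) =>
      e i.1 i.2) pi_measurableSpace_eq _ _ fun F => ?_
    rw [map_coe_path_box hX Q F, e2 F, h F]

lemma map_path_eq_iff_forall_maxFun {X Y : Ω' → PathSpace p d} (hX : Measurable X)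
    (hY : Measurable Y) {Q : Measure Ω'} [IsProbabilityMeasure Q] :
    Q.map X = Q.map Y ↔ ∀ F, Q {ω | maxFun F (X ω) ≤ 1} = Q {ω | maxFun F (Y ω) ≤ 1} := by
  have hms : ∀ F : Finset (((Fin p → ℝ) × Fin d) × ℝ≥0),
    MeasurableSet {f : PathSpace p d | maxFun F f ≤ 1} := fun F =>
      measurableSet_le (measurable_maxFun F) measurable_const
  refine ⟨fun hs F => ?_, fun hs => ?_⟩
  · have := congrArg (fun μ => μ {f | maxFun F f ≤ 1}) hs
    simp only [Measure.map_apply hX (hms F), Measure.map_apply hY (hms F)] at this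
    exact this
  · have := Measure.isProbabilityMeasure_map (μ := Q) hX.aemeasurable
    refine ext_of_forall_maxFun _ _ fun F => ?_
    rw [Measure.map_apply hX (hms F), Measure.map_apply hY (hms F)]
    exact hs F

lemma isStationary_iff_forall_maxFun {X : Ω' → PathSpace p d} (hX : Measurable X)
    {Q : Measure Ω'} [IsProbabilityMeasure Q] :
    IsStationary X Q ↔ ∀ h F, Q {ω | maxFun F (shift h (X ω)) ≤ 1} =
      Q {ω | maxFun F (X ω) ≤ 1} :=
  forall_congr' fun h => map_path_eq_iff_forall_maxFun ((measurable_shift h).comp hX) hX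

/-- Shifting the path amounts to shifting the test family, and `x ↦ exp (-x)` is injective on finite
moments. -/
lemma isStationary_iff_maxMoment {α : ℝ} (hα : 0 < α) {Z : Ω → PathSpace p d} (hZ : Measurable Z)
    {P : Measure Ω} [IsProbabilityMeasure P] {X : Ω' → PathSpace p d} (hX : Measurable X)
    {Q : Measure Ω'} [IsProbabilityMeasure Q] (hfin : ∀ F, maxMoment α Z P F ≠ ∞)
    (hXZ : IsSpectralProcess α Z P X Q) :
    IsStationary X Q ↔
      ∀ h F, maxMoment α (fun ω => shift h (Z ω)) P F = maxMoment α Z P F := by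
  rw [isStationary_iff_forall_maxFun hX]
  have hq := (isSpectralProcess_iff hα hZ hX hfin).1 hXZ
  refine forall₂_congr fun h F => ?_
  have e1 : maxMoment α (fun ω => shift h (Z ω)) P F = maxMoment α Z P (shiftFamily F h) := by
    simp only [maxMoment, maxFun_shiftFamily]
  simp_rw [e1, ← maxFun_shiftFamily]
  rw [hq, hq, ENNReal.ofReal_eq_ofReal_iff (Real.exp_pos _).le (Real.exp_pos _).le, Real.exp_eq_exp,
    neg_inj, ENNReal.toReal_eq_toReal_iff' (hfin _) (hfin _)]

end MaxStable

/-! ### Tilted measures and their recovery from moments. -/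

namespace MaxStable
open Set Filter Topology

variable {p d : ℕ} {Ω : Type*} [MeasurableSpace Ω]

/-- The measure `A ↦ E[ρ(Z)^α 1(Z / ρ(Z) ∈ A)]`. -/
noncomputable def tiltMeasure (α : ℝ) (ρ : PathSpace p d → ℝ≥0) (Z : Ω → PathSpace p d)
    (P : Measure Ω) : Measure (PathSpace p d) :=
  (P.withDensity fun ω => (ρ (Z ω) : ℝ≥0∞) ^ α).map fun ω => (ρ (Z ω))⁻¹ • Z ω

lemma lintegral_tiltMeasure (α : ℝ) {ρ : PathSpace p d → ℝ≥0} (hρ : Measurable ρ)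
    {Z : Ω → PathSpace p d} (hZ : Measurable Z) (P : Measure Ω) {G : PathSpace p d → ℝ≥0∞}
    (hG : Measurable G) :
    ∫⁻ f, G f ∂(tiltMeasure α ρ Z P) =
      ∫⁻ ω, (ρ (Z ω) : ℝ≥0∞) ^ α * G ((ρ (Z ω))⁻¹ • Z ω) ∂P := by
  have hm : Measurable fun ω => (ρ (Z ω))⁻¹ • Z ω := measurable_smul_path (hρ.comp hZ).inv hZ
  have hd : Measurable fun ω => (ρ (Z ω) : ℝ≥0∞) ^ α :=
    (hρ.comp hZ).coe_nnreal_ennreal.pow_const α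
  rw [tiltMeasure, lintegral_map hG hm]
  exact lintegral_withDensity_eq_lintegral_mul _ hd (hG.comp hm)

lemma tiltMeasure_univ (α : ℝ) {ρ : PathSpace p d → ℝ≥0} (hρ : Measurable ρ)
    {Z : Ω → PathSpace p d} (hZ : Measurable Z) (P : Measure Ω) :
    tiltMeasure α ρ Z P univ = ∫⁻ ω, (ρ (Z ω) : ℝ≥0∞) ^ α ∂P := by
  have := lintegral_tiltMeasure α hρ hZ P (G := fun _ => 1) measurable_const
  simpa using this

lemma tiltMeasure_maxFun_le_one {α : ℝ} (hα : 0 < α) {Z : Ω → PathSpace p d} (hZ : Measurable Z)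
    (P : Measure Ω) (t : Fin p → ℝ) (k : Fin d) (F : Finset (((Fin p → ℝ) × Fin d) × ℝ≥0)) :
    tiltMeasure α (fun f => f t k) Z P {f | maxFun F f ≤ 1} =
      ∫⁻ ω, (Z ω t k : ℝ≥0∞) ^ α * {f | maxFun F f ≤ f t k}.indicator 1 (Z ω) ∂P := by
  have hms : MeasurableSet {f : PathSpace p d | maxFun F f ≤ 1} :=
    measurableSet_le (measurable_maxFun F) measurable_const
  rw [← lintegral_indicator_one hms, lintegral_tiltMeasure α (measurable_eval_apply t k) hZ P
    (measurable_one.indicator hms)]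
  refine lintegral_congr fun ω => ?_
  rcases eq_or_ne (Z ω t k) 0 with h | h
  · simp [h, hα]
  · congr 1
    have : maxFun F ((Z ω t k)⁻¹ • Z ω) ≤ 1 ↔ maxFun F (Z ω) ≤ Z ω t k := by
      rw [maxFun_smul, inv_mul_le_iff₀ (by positivity), mul_one]
    simp only [indicator_apply, mem_ofPred_eq, this, Pi.one_apply]

lemma IsHomogeneousFunctional.zero_map_smul {Γ : PathSpace p d → ℝ≥0∞}
    (hΓ : IsHomogeneousFunctional 0 Γ) {c : ℝ≥0} (hc : 0 < c) (f : PathSpace p d) :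
    Γ (c • f) = Γ f := by
  rw [hΓ.map_smul c f hc, ENNReal.rpow_zero, one_mul]

/-- Degree `0` makes the normalisation by `ρ` invisible; where `ρ` vanishes the weight is `0` on
both sides, even if `Γ` is infinite. -/
lemma lintegral_tiltMeasure_of_homogeneous {α : ℝ} (hα : 0 < α) {ρ : PathSpace p d → ℝ≥0}
    (hρ : Measurable ρ) {Z : Ω → PathSpace p d} (hZ : Measurable Z) (P : Measure Ω)
    {Γ : PathSpace p d → ℝ≥0∞} (hΓ : IsHomogeneousFunctional 0 Γ) :
    ∫⁻ f, Γ f ∂(tiltMeasure α ρ Z P) = ∫⁻ ω, (ρ (Z ω) : ℝ≥0∞) ^ α * Γ (Z ω) ∂P := by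
  rw [lintegral_tiltMeasure α hρ hZ P hΓ.measurable]
  refine lintegral_congr fun ω => ?_
  rcases eq_or_ne (ρ (Z ω)) 0 with h | h
  · simp [h, hα]
  · rw [hΓ.zero_map_smul (by positivity)]

/-- This is the right derivative of `c ↦ max (c a) m` at `c = 1`. Taking it from the right makes a
tie `m = a` count, which yields the closed condition `m ≤ a`. -/
lemma tendsto_max_increment (a m : ℝ≥0) :
    Tendsto (fun n : ℕ => ((n : ℝ≥0) + 1) *
      (max ((1 + 1 / ((n : ℝ≥0) + 1)) * a) m - max a m)) atTop (𝓝 (if m ≤ a then a else 0)) := by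
  split_ifs with h
  · refine tendsto_const_nhds.congr fun n => ?_
    have h1 : m ≤ (1 + 1 / ((n : ℝ≥0) + 1)) * a :=
      h.trans (le_mul_of_one_le_left (zero_le) le_self_add)
    rw [max_eq_left h, max_eq_left h1, add_mul 1, one_mul, add_tsub_cancel_left, ← mul_assoc,
      mul_one_div_cancel (by positivity), one_mul]
  · have hlim : Tendsto (fun n : ℕ => (1 + 1 / ((n : ℝ≥0) + 1)) * a) atTop (𝓝 ((1 + 0) * a)) :=
      (tendsto_const_nhds.add tendsto_one_div_add_atTop_nhds_zero_nat).mul_const a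
    rw [add_zero, one_mul] at hlim
    refine tendsto_const_nhds.congr' ?_
    filter_upwards [hlim.eventually (gt_mem_nhds (not_le.1 h))] with n hn
    rw [max_eq_right hn.le, max_eq_right (not_le.1 h).le, tsub_self, mul_zero]

lemma max_increment_le (a m : ℝ≥0) (n : ℕ) :
    ((n : ℝ≥0) + 1) * (max ((1 + 1 / ((n : ℝ≥0) + 1)) * a) m - max a m) ≤ a := by
  have h : max ((1 + 1 / ((n : ℝ≥0) + 1)) * a) m - max a m ≤ 1 / ((n : ℝ≥0) + 1) * a := by
    rw [tsub_le_iff_right, add_mul, one_mul, add_comm]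
    refine max_le (by gcongr; exact le_max_left _ _) ?_
    exact (le_max_right a m).trans le_add_self
  calc _ ≤ ((n : ℝ≥0) + 1) * (1 / ((n : ℝ≥0) + 1) * a) := by gcongr
    _ = a := by rw [← mul_assoc, mul_one_div_cancel (by positivity), one_mul]

/-- Differentiation under the expectation, dominated by `Z_k(t)^α`. The exponent `1 / α` on the
weight makes it enter linearly after raising to the power `α`. -/
lemma tendsto_maxMoment_increment {α : ℝ} (hα : 0 < α) {Z : Ω → PathSpace p d} (hZ : Measurable Z)
    {P : Measure Ω} (hfin : ∀ F, maxMoment α Z P F ≠ ∞)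
    (F : Finset (((Fin p → ℝ) × Fin d) × ℝ≥0)) (t : Fin p → ℝ) (k : Fin d) :
    Tendsto (fun n : ℕ => ((n : ℝ≥0∞) + 1) *
      (maxMoment α Z P (insertFamily F t k ((1 + 1 / ((n : ℝ≥0) + 1)) ^ (1 / α))) -
        maxMoment α Z P (insertFamily F t k 1))) atTop
      (𝓝 (∫⁻ ω, (Z ω t k : ℝ≥0∞) ^ α * {f | maxFun F f ≤ f t k}.indicator 1 (Z ω) ∂P)) := by
  set a : Ω → ℝ≥0 := fun ω => Z ω t k ^ α with ha
  set m : Ω → ℝ≥0 := fun ω => maxFun F (Z ω) ^ α with hm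
  have ham : Measurable a := (measurable_apply hZ t k).pow_const α
  have hmm : Measurable m := ((measurable_maxFun F).comp hZ).pow_const α
  have hmom : ∀ c : ℝ≥0, maxMoment α Z P (insertFamily F t k (c ^ (1 / α))) =
      ∫⁻ ω, ((max (c * a ω) (m ω) : ℝ≥0) : ℝ≥0∞) ∂P := by
    intro c
    refine lintegral_congr fun ω => ?_
    rw [maxFun_insertFamily, ← ENNReal.coe_rpow_of_nonneg _ hα.le,
      (NNReal.monotone_rpow_of_nonneg hα.le).map_max, NNReal.mul_rpow, ← NNReal.rpow_mul,
      one_div_mul_cancel hα.ne', NNReal.rpow_one]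
  have hval : ∫⁻ ω, (Z ω t k : ℝ≥0∞) ^ α * {f | maxFun F f ≤ f t k}.indicator 1 (Z ω) ∂P =
      ∫⁻ ω, ((if m ω ≤ a ω then a ω else 0 : ℝ≥0) : ℝ≥0∞) ∂P := by
    refine lintegral_congr fun ω => ?_
    simp only [ha, hm, NNReal.rpow_le_rpow_iff hα, indicator_apply, mem_ofPred_eq, Pi.one_apply]
    split_ifs
    · rw [mul_one, ENNReal.coe_rpow_of_nonneg _ hα.le]
    · simp
  have hone : maxMoment α Z P (insertFamily F t k 1) =
      ∫⁻ ω, ((max (a ω) (m ω) : ℝ≥0) : ℝ≥0∞) ∂P := by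
    simpa using hmom 1
  have hseq : ∀ n : ℕ, ((n : ℝ≥0∞) + 1) *
      (maxMoment α Z P (insertFamily F t k ((1 + 1 / ((n : ℝ≥0) + 1)) ^ (1 / α))) -
        maxMoment α Z P (insertFamily F t k 1)) =
      ∫⁻ ω, ((((n : ℝ≥0) + 1) * (max ((1 + 1 / ((n : ℝ≥0) + 1)) * a ω) (m ω) -
        max (a ω) (m ω)) : ℝ≥0) : ℝ≥0∞) ∂P := by
    intro n
    have hfin1 := hone ▸ hfin (insertFamily F t k 1)
    rw [hmom, hone, ← lintegral_sub (ham.max hmm).coe_nnreal_ennreal hfin1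
      (Eventually.of_forall fun ω => ENNReal.coe_le_coe.2
        (max_le_max_right _ (le_mul_of_one_le_left (zero_le) le_self_add))),
      ← lintegral_const_mul _ (by fun_prop)]
    refine lintegral_congr fun ω => ?_
    push_cast
    rfl
  rw [hval]
  simp_rw [hseq]
  refine tendsto_lintegral_of_dominated_convergence (fun ω => (a ω : ℝ≥0∞)) (fun n => by fun_prop)
    (fun n => Eventually.of_forall fun ω => ENNReal.coe_le_coe.2 (max_increment_le _ _ n)) ?_
    (Eventually.of_forall fun ω => ENNReal.tendsto_coe.2 (tendsto_max_increment _ _))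
  refine ne_top_of_le_ne_top (hone ▸ hfin (insertFamily F t k 1)) (lintegral_mono fun ω => ?_)
  exact ENNReal.coe_le_coe.2 (le_max_left _ _)

variable {Ω' : Type*} [MeasurableSpace Ω']

/-- The moments `E[(maxFun F Z)^α]` determine the tilted measures. -/
lemma tiltMeasure_eq_of_maxMoment_eq {α : ℝ} (hα : 0 < α) {Z : Ω → PathSpace p d}
    (hZ : Measurable Z) {P : Measure Ω} {Z' : Ω' → PathSpace p d} (hZ' : Measurable Z')
    {P' : Measure Ω'} (hfin : ∀ F, maxMoment α Z P F ≠ ∞)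
    (heq : ∀ F, maxMoment α Z P F = maxMoment α Z' P' F) (t : Fin p → ℝ) (k : Fin d) :
    tiltMeasure α (fun f => f t k) Z P = tiltMeasure α (fun f => f t k) Z' P' := by
  have : IsFiniteMeasure (tiltMeasure α (fun f => f t k) Z P) := by
    refine ⟨?_⟩
    rw [tiltMeasure_univ α (measurable_eval_apply t k) hZ P]
    have := hfin {((t, k), 1)}
    simp only [maxMoment, maxFun, Finset.sup_singleton, one_mul] at this
    exact this.lt_top
  refine ext_of_forall_maxFun _ _ fun F => ?_
  rw [tiltMeasure_maxFun_le_one hα hZ, tiltMeasure_maxFun_le_one hα hZ']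
  refine tendsto_nhds_unique (tendsto_maxMoment_increment hα hZ hfin F t k) ?_
  refine (tendsto_maxMoment_increment hα hZ' (fun F => heq F ▸ hfin F) F t k).congr fun n => ?_
  rw [heq, heq]

end MaxStable

/-! ### The shift formula, stationarity and the laws of `Θ^{[h,k]}`. -/

namespace MaxStable
open Set Filter Topology

variable {p d : ℕ} {Ω : Type*} [MeasurableSpace Ω]

/-- `E[Z_k(h)^α Γ(Z)] = E[Z_k(0)^α Γ(B^h Z)]` for all `h`, `k` and `0`-homogeneous `Γ`. -/
def HasShiftFormula (α : ℝ) (Z : Ω → PathSpace p d) (P : Measure Ω) : Prop :=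
  ∀ (h : Fin p → ℝ) (Γ : PathSpace p d → ℝ≥0∞) (k : Fin d), IsHomogeneousFunctional 0 Γ →
    ∫⁻ ω, (Z ω h k : ℝ≥0∞) ^ α * Γ (Z ω) ∂P =
      ∫⁻ ω, (Z ω 0 k : ℝ≥0∞) ^ α * Γ (shift h (Z ω)) ∂P

lemma IsHomogeneousFunctional.comp_shift {β : ℝ} {H : PathSpace p d → ℝ≥0∞}
    (hH : IsHomogeneousFunctional β H) (h : Fin p → ℝ) :
    IsHomogeneousFunctional β fun f => H (shift h f) :=
  ⟨hH.measurable.comp (measurable_shift h), fun c f hc => by rw [shift_smul, hH.map_smul c _ hc]⟩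

lemma IsHomogeneousFunctional.div {β : ℝ} {A B : PathSpace p d → ℝ≥0∞}
    (hA : IsHomogeneousFunctional β A) (hB : IsHomogeneousFunctional β B) :
    IsHomogeneousFunctional 0 fun f => A f / B f := by
  refine ⟨hA.measurable.div hB.measurable, fun c f hc => ?_⟩
  have hc' : (c : ℝ≥0∞) ≠ 0 := by exact_mod_cast hc.ne'
  rw [hA.map_smul c f hc, hB.map_smul c f hc, ENNReal.rpow_zero, one_mul,
    ENNReal.mul_div_mul_left _ _ (ENNReal.rpow_pos (pos_iff_ne_zero.2 hc') ENNReal.coe_ne_top).ne'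
      (ENNReal.rpow_ne_top_of_ne_zero hc' ENNReal.coe_ne_top)]

lemma IsHomogeneousFunctional.mul {β γ : ℝ} {A B : PathSpace p d → ℝ≥0∞}
    (hA : IsHomogeneousFunctional β A) (hB : IsHomogeneousFunctional γ B) :
    IsHomogeneousFunctional (β + γ) fun f => A f * B f := by
  refine ⟨hA.measurable.mul hB.measurable, fun c f hc => ?_⟩
  have hc' : (c : ℝ≥0∞) ≠ 0 := by exact_mod_cast hc.ne'
  rw [hA.map_smul c f hc, hB.map_smul c f hc, ENNReal.rpow_add _ _ hc' ENNReal.coe_ne_top]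
  ring

lemma isHomogeneousFunctional_rpow {α : ℝ} (hα : 0 < α) {ρ : PathSpace p d → ℝ≥0}
    (hρ : Measurable ρ) (hs : ∀ c f, ρ (c • f) = c * ρ f) :
    IsHomogeneousFunctional α fun f => (ρ f : ℝ≥0∞) ^ α :=
  ⟨hρ.coe_nnreal_ennreal.pow_const α, fun c f _ => by
    rw [hs, ENNReal.coe_mul, ENNReal.mul_rpow_of_nonneg _ _ hα.le]⟩

lemma isHomogeneousFunctional_apply {α : ℝ} (hα : 0 < α) (t : Fin p → ℝ) (k : Fin d) :
    IsHomogeneousFunctional α fun f : PathSpace p d => (f t k : ℝ≥0∞) ^ α :=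
  isHomogeneousFunctional_rpow hα (measurable_eval_apply t k) fun c f => by simp

/-- `Z` and `B^h Z` have equal moments, hence equal tilts at `(h, k)`, and the tilting coordinate of
`B^h Z` there is `Z_k(0)`. -/
lemma hasShiftFormula_of_maxMoment_shift {α : ℝ} (hα : 0 < α) {Z : Ω → PathSpace p d}
    (hZ : Measurable Z) {P : Measure Ω} (hfin : ∀ F, maxMoment α Z P F ≠ ∞)
    (heq : ∀ h F, maxMoment α (fun ω => shift h (Z ω)) P F = maxMoment α Z P F) :
    HasShiftFormula α Z P := by
  intro h Γ k hΓ
  have hZ' : Measurable fun ω => shift h (Z ω) := (measurable_shift h).comp hZ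
  have hρ := measurable_eval_apply (p := p) (d := d) h k
  have h1 := tiltMeasure_eq_of_maxMoment_eq hα hZ hZ' hfin (fun F => (heq h F).symm) h k
  have h2 := lintegral_tiltMeasure_of_homogeneous hα hρ hZ P hΓ
  have h3 := lintegral_tiltMeasure_of_homogeneous hα hρ hZ' P hΓ
  simpa [sub_self] using h2.symm.trans ((congrArg (fun μ => ∫⁻ f, Γ f ∂μ) h1).trans h3)

lemma HasShiftFormula.shift_eq {α : ℝ} {Z : Ω → PathSpace p d} {P : Measure Ω}
    (hs : HasShiftFormula α Z P) (t h : Fin p → ℝ) (k : Fin d) {Γ : PathSpace p d → ℝ≥0∞}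
    (hΓ : IsHomogeneousFunctional 0 Γ) :
    ∫⁻ ω, (Z ω t k : ℝ≥0∞) ^ α * Γ (Z ω) ∂P =
      ∫⁻ ω, (Z ω (t - h) k : ℝ≥0∞) ^ α * Γ (shift h (Z ω)) ∂P := by
  rw [hs t Γ k hΓ, hs (t - h) _ k (hΓ.comp_shift h)]
  simp_rw [shift_shift, add_sub_cancel]

/-- The expectation of an `α`-homogeneous functional that vanishes where finitely many coordinates
vanish is invariant under shifts. -/
lemma HasShiftFormula.lintegral_shift {α : ℝ} (hα : 0 < α) {Z : Ω → PathSpace p d}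
    (hZ : Measurable Z) {P : Measure Ω} (hs : HasShiftFormula α Z P)
    (F : Finset (((Fin p → ℝ) × Fin d) × ℝ≥0)) {H : PathSpace p d → ℝ≥0∞}
    (hH : IsHomogeneousFunctional α H)
    (hz : ∀ f, ∑ a ∈ F, (a.2 : ℝ≥0∞) ^ α * (f a.1.1 a.1.2 : ℝ≥0∞) ^ α = 0 → H f = 0)
    (h : Fin p → ℝ) : ∫⁻ ω, H (shift h (Z ω)) ∂P = ∫⁻ ω, H (Z ω) ∂P := by
  set S : PathSpace p d → ℝ≥0∞ := fun f =>
    ∑ a ∈ F, (a.2 : ℝ≥0∞) ^ α * (f a.1.1 a.1.2 : ℝ≥0∞) ^ α with hS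
  have hSh : IsHomogeneousFunctional α S := by
    refine ⟨Finset.measurable_fun_sum F fun a _ =>
      ((isHomogeneousFunctional_apply hα _ _).measurable).const_mul _, fun c f hc => ?_⟩
    simp only [hS, Finset.mul_sum]
    refine Finset.sum_congr rfl fun a _ => ?_
    have := (isHomogeneousFunctional_apply hα a.1.1 a.1.2).map_smul c f hc
    rw [this]; ring
  have hStop : ∀ f, S f ≠ ∞ := fun f => ENNReal.sum_ne_top.2 fun a _ =>
    ENNReal.mul_ne_top (ENNReal.rpow_ne_top_of_nonneg hα.le ENNReal.coe_ne_top)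
      (ENNReal.rpow_ne_top_of_nonneg hα.le ENNReal.coe_ne_top)
  have hΓ := hH.div hSh
  -- `H / S` has degree `0`, so the shift formula applies to each term. By `hz` the identity
  -- survives at `S f = 0`, where both sides vanish.
  have hdec : ∀ f, H f = ∑ a ∈ F, (a.2 : ℝ≥0∞) ^ α * ((f a.1.1 a.1.2 : ℝ≥0∞) ^ α * (H f / S f)) := by
    intro f
    simp_rw [← mul_assoc]
    rw [← Finset.sum_mul]
    exact (ENNReal.mul_div_cancel' (hz f) (fun h => absurd h (hStop f))).symm
  have hm : ∀ a : ((Fin p → ℝ) × Fin d) × ℝ≥0, ∀ g : PathSpace p d → PathSpace p d,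
      Measurable g → Measurable fun ω =>
        (g (Z ω) a.1.1 a.1.2 : ℝ≥0∞) ^ α * (H (g (Z ω)) / S (g (Z ω))) := fun a g hg =>
    ((isHomogeneousFunctional_apply hα _ _).measurable.comp (hg.comp hZ)).mul
      (hΓ.measurable.comp (hg.comp hZ))
  have hm0 : ∀ a : ((Fin p → ℝ) × Fin d) × ℝ≥0, Measurable fun ω =>
      (Z ω a.1.1 a.1.2 : ℝ≥0∞) ^ α * (H (Z ω) / S (Z ω)) := fun a => hm a id measurable_id
  rw [lintegral_congr fun ω => hdec (shift h (Z ω)), lintegral_congr fun ω => hdec (Z ω),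
    lintegral_finsetSum _ fun a _ => (hm a _ (measurable_shift h)).const_mul _,
    lintegral_finsetSum _ fun a _ => (hm0 a).const_mul _]
  refine Finset.sum_congr rfl fun a _ => ?_
  rw [lintegral_const_mul _ (hm a _ (measurable_shift h)),
    lintegral_const_mul _ (hm0 a)]
  congr 1
  exact (hs.shift_eq a.1.1 h a.1.2 hΓ).symm

lemma HasShiftFormula.maxMoment_shift {α : ℝ} (hα : 0 < α) {Z : Ω → PathSpace p d}
    (hZ : Measurable Z) {P : Measure Ω} (hs : HasShiftFormula α Z P) (h : Fin p → ℝ)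
    (F : Finset (((Fin p → ℝ) × Fin d) × ℝ≥0)) :
    maxMoment α (fun ω => shift h (Z ω)) P F = maxMoment α Z P F :=
  hs.lintegral_shift hα hZ F
    (isHomogeneousFunctional_rpow hα (measurable_maxFun F) (maxFun_smul F))
    (fun f hf => le_antisymm ((maxFun_rpow_le_sum hα F f).trans_eq hf) (zero_le)) h

/-- `Θ^{[h,k]}` and `B^h Θ^{[0,k]}` have the same law, for all `h` and `k`. -/
def HasThetaShift (α : ℝ) (Z : Ω → PathSpace p d) (P : Measure Ω) : Prop :=
  ∀ (h : Fin p → ℝ) (k : Fin d),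
    thetaCompLaw α Z P h k = (thetaCompLaw α Z P 0 k).map (shift h)

lemma hasShiftFormula_iff_tiltMeasure {α : ℝ} (hα : 0 < α) {Z : Ω → PathSpace p d}
    (hZ : Measurable Z) {P : Measure Ω} :
    HasShiftFormula α Z P ↔ ∀ h k, tiltMeasure α (fun f => f h k) Z P =
      (tiltMeasure α (fun f => f 0 k) Z P).map (shift h) := by
  constructor
  · intro hs h k
    refine Measure.ext fun A hA => ?_
    have hG : Measurable (A.indicator (1 : PathSpace p d → ℝ≥0∞)) := measurable_one.indicator hA
    rw [← lintegral_indicator_one hA, ← lintegral_indicator_one hA,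
      lintegral_map hG (measurable_shift h),
      lintegral_tiltMeasure α (measurable_eval_apply h k) hZ P hG,
      lintegral_tiltMeasure α (measurable_eval_apply 0 k) hZ P (G := fun f => A.indicator 1 (shift h f))
        (hG.comp (measurable_shift h))]
    -- Normalising by the tilting coordinate makes an arbitrary event into a functional of degree
    -- `0`.
    have := hs h (fun f => A.indicator 1 ((f h k)⁻¹ • f)) k
      ⟨hG.comp (measurable_smul_path (measurable_eval_apply h k).inv measurable_id),
        fun c f hc => ?_⟩
    · simpa [sub_self, shift_smul] using this
    · rw [ENNReal.rpow_zero, one_mul]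
      congr 1
      rw [smul_smul]
      congr 1
      rw [ContinuousMap.smul_apply, Pi.smul_apply, smul_eq_mul, mul_inv, mul_right_comm,
        inv_mul_cancel₀ hc.ne', one_mul]
  · intro ht h Γ k hΓ
    rw [← lintegral_tiltMeasure_of_homogeneous hα (measurable_eval_apply h k) hZ P hΓ, ht h k,
      lintegral_map hΓ.measurable (measurable_shift h)]
    exact lintegral_tiltMeasure_of_homogeneous hα (measurable_eval_apply 0 k) hZ P
      (hΓ.comp_shift h)

/-- Equality of the unnormalised tilts forces equal total masses, so normalisation preserves it; in
the degenerate case the constant path is shift invariant. -/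
lemma HasShiftFormula.hasThetaShift {α : ℝ} (hα : 0 < α) {Z : Ω → PathSpace p d}
    (hZ : Measurable Z) {P : Measure Ω} (hs : HasShiftFormula α Z P) : HasThetaShift α Z P := by
  intro h k
  have ht := (hasShiftFormula_iff_tiltMeasure hα hZ).1 hs h k
  have hc : ∫⁻ ω, (Z ω h k : ℝ≥0∞) ^ α ∂P = ∫⁻ ω, (Z ω 0 k : ℝ≥0∞) ^ α ∂P := by
    rw [← tiltMeasure_univ α (measurable_eval_apply h k) hZ P,
      ← tiltMeasure_univ α (measurable_eval_apply 0 k) hZ P, ht,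
      Measure.map_apply (measurable_shift h) MeasurableSet.univ, preimage_univ]
  unfold thetaCompLaw
  rw [hc]
  split_ifs
  · rw [Measure.map_dirac' (measurable_shift h)]
    rfl
  · have e1 : ∀ t, tiltedLaw α (fun f : PathSpace p d => f t k) Z P =
        (∫⁻ ω, (Z ω t k : ℝ≥0∞) ^ α ∂P)⁻¹ • tiltMeasure α (fun f => f t k) Z P := fun _ => rfl
    rw [e1, e1, hc, ht, Measure.map_smul]

/-- The density `f_k(t)^α` cancels the normalisation, leaving only the restriction to paths with
`f_k(t) ≠ 0`. -/
lemma lintegral_tiltMeasure_of_alpha_homogeneous {α : ℝ} (hα : 0 < α) {Z : Ω → PathSpace p d}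
    (hZ : Measurable Z) (P : Measure Ω) (t : Fin p → ℝ) (k : Fin d) {H : PathSpace p d → ℝ≥0∞}
    (hH : IsHomogeneousFunctional α H) :
    ∫⁻ f, H f ∂(tiltMeasure α (fun f => f t k) Z P) =
      ∫⁻ ω, {f : PathSpace p d | f t k ≠ 0}.indicator H (Z ω) ∂P := by
  rw [lintegral_tiltMeasure α (measurable_eval_apply t k) hZ P hH.measurable]
  refine lintegral_congr fun ω => ?_
  rcases eq_or_ne (Z ω t k) 0 with h | h
  · simp [h, hα]
  · have h' : ((Z ω t k : ℝ≥0) : ℝ≥0∞) ≠ 0 := by exact_mod_cast h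
    rw [hH.map_smul _ _ (by positivity), ← mul_assoc, ← ENNReal.mul_rpow_of_nonneg _ _ hα.le,
      ENNReal.coe_inv h, ENNReal.mul_inv_cancel h' ENNReal.coe_ne_top, ENNReal.one_rpow, one_mul]
    simp [indicator, h]

end MaxStable

/-! ### From the normalised laws back to the shift formula. -/

namespace MaxStable
open Set Filter Topology

variable {p d : ℕ} {Ω : Type*} [MeasurableSpace Ω]

/-- `E[Z_k(t)^α 1(Z_k(s) > 0)]`. -/
noncomputable def crossMoment (α : ℝ) (Z : Ω → PathSpace p d) (P : Measure Ω) (k : Fin d)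
    (s t : Fin p → ℝ) : ℝ≥0∞ :=
  ∫⁻ ω, {f : PathSpace p d | f s k ≠ 0}.indicator (fun f => (f t k : ℝ≥0∞) ^ α) (Z ω) ∂P

lemma crossMoment_eq_lintegral_tiltMeasure_left {α : ℝ} (hα : 0 < α) {Z : Ω → PathSpace p d}
    (hZ : Measurable Z) (P : Measure Ω) (k : Fin d) (s t : Fin p → ℝ) :
    ∫⁻ f, (f t k : ℝ≥0∞) ^ α ∂(tiltMeasure α (fun f => f s k) Z P) = crossMoment α Z P k s t :=
  lintegral_tiltMeasure_of_alpha_homogeneous hα hZ P s k (isHomogeneousFunctional_apply hα t k)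

lemma measurableSet_apply_ne_zero (s : Fin p → ℝ) (k : Fin d) :
    MeasurableSet {f : PathSpace p d | f s k ≠ 0} :=
  (measurable_eval_apply s k) (measurableSet_singleton 0).compl

lemma isHomogeneousFunctional_indicator_ne_zero (s : Fin p → ℝ) (k : Fin d) :
    IsHomogeneousFunctional 0 ({f : PathSpace p d | f s k ≠ 0}.indicator 1) := by
  refine ⟨measurable_one.indicator (measurableSet_apply_ne_zero s k), fun c f hc => ?_⟩
  simp [indicator, hc.ne']

/-- The tilts at `s` and at `t` both compute the same cross moment; comparing the two expressions is
what yields multiplicativity of the moment ratio. -/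
lemma crossMoment_eq_lintegral_tiltMeasure_right {α : ℝ} (hα : 0 < α) {Z : Ω → PathSpace p d}
    (hZ : Measurable Z) (P : Measure Ω) (k : Fin d) (s t : Fin p → ℝ) :
    ∫⁻ f, {f : PathSpace p d | f s k ≠ 0}.indicator 1 f ∂(tiltMeasure α (fun f => f t k) Z P) =
      crossMoment α Z P k s t := by
  rw [lintegral_tiltMeasure_of_homogeneous hα (measurable_eval_apply t k) hZ P
    (isHomogeneousFunctional_indicator_ne_zero s k)]
  refine lintegral_congr fun ω => ?_
  by_cases h : Z ω s k = 0 <;> simp [indicator, h]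

lemma crossMoment_le {α : ℝ} {Z : Ω → PathSpace p d} (P : Measure Ω) (k : Fin d)
    (s t : Fin p → ℝ) : crossMoment α Z P k s t ≤ ∫⁻ ω, (Z ω t k : ℝ≥0∞) ^ α ∂P :=
  lintegral_mono fun ω => indicator_le_self _ (fun f : PathSpace p d => (f t k : ℝ≥0∞) ^ α) (Z ω)

/-- By continuity of the paths, `Z_k` is positive at `0` and at a nearby point `v / (n + 1)` on an
event of positive probability. -/
lemma exists_crossMoment_ne_zero {α : ℝ} (hα : 0 < α) {Z : Ω → PathSpace p d} (hZ : Measurable Z)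
    (P : Measure Ω) (k : Fin d) (h0 : ∫⁻ ω, (Z ω 0 k : ℝ≥0∞) ^ α ∂P ≠ 0) (v : Fin p → ℝ) :
    ∃ n : ℕ, crossMoment α Z P k (-((1 / ((n : ℝ) + 1)) • v)) 0 ≠ 0 := by
  by_contra! hcon
  refine h0 ?_
  have hmeas : ∀ s, Measurable fun ω => {f : PathSpace p d | f s k ≠ 0}.indicator
      (fun f => (f 0 k : ℝ≥0∞) ^ α) (Z ω) := fun s =>
    ((isHomogeneousFunctional_apply hα 0 k).measurable.indicator
      (measurableSet_apply_ne_zero s k)).comp hZ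
  have hae : ∀ᵐ ω ∂P, ∀ n : ℕ, {f : PathSpace p d | f (-((1 / ((n : ℝ) + 1)) • v)) k ≠ 0}.indicator
      (fun f => (f 0 k : ℝ≥0∞) ^ α) (Z ω) = 0 :=
    ae_all_iff.2 fun n => (lintegral_eq_zero_iff (hmeas _)).1 (hcon n)
  have hm0 : Measurable fun ω => (Z ω 0 k : ℝ≥0∞) ^ α :=
    (isHomogeneousFunctional_apply hα 0 k).measurable.comp hZ
  rw [lintegral_eq_zero_iff hm0]
  filter_upwards [hae] with ω hω
  by_contra hne
  have hpos : Z ω 0 k ≠ 0 := fun h => hne (by simp [h, hα])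
  have hlim : Tendsto (fun n : ℕ => -((1 / ((n : ℝ) + 1)) • v)) atTop (𝓝 0) := by
    have := ((tendsto_one_div_add_atTop_nhds_zero_nat (𝕜 := ℝ)).smul_const v).neg
    simpa using this
  have hcont : Continuous fun t => Z ω t k := by fun_prop
  have := ((hcont.tendsto 0).comp hlim).eventually (isOpen_ne.mem_nhds hpos)
  obtain ⟨n, hn⟩ := this.exists
  have hz := hω n
  rw [indicator_of_mem (by exact hn)] at hz
  exact hne hz

lemma tiltedLaw_eq_smul (α : ℝ) (ρ : PathSpace p d → ℝ≥0) (Z : Ω → PathSpace p d)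
    (P : Measure Ω) :
    tiltedLaw α ρ Z P = (∫⁻ ω, (ρ (Z ω) : ℝ≥0∞) ^ α ∂P)⁻¹ • tiltMeasure α ρ Z P := rfl

lemma lintegral_rpow_dirac_one (α : ℝ) (t : Fin p → ℝ) (k : Fin d) (hα : 0 < α) :
    ∫⁻ f : PathSpace p d, (f t k : ℝ≥0∞) ^ α
      ∂(Measure.dirac (ContinuousMap.const _ fun _ => 1)) = 1 := by
  rw [lintegral_dirac' _ (isHomogeneousFunctional_apply hα t k).measurable]
  simp

/-- If `E[Z_k(t)^α] = 0`, then under a tilt at any other point the path vanishes at `(t, k)` almost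
surely, which the constant path `1` does not. So one side cannot be degenerate alone. -/
lemma HasThetaShift.moment_eq_zero_iff {α : ℝ} (hα : 0 < α) {Z : Ω → PathSpace p d}
    (hZ : Measurable Z) {P : Measure Ω}
    (ht : HasThetaShift α Z P) (h : Fin p → ℝ) (k : Fin d) :
    ∫⁻ ω, (Z ω h k : ℝ≥0∞) ^ α ∂P = 0 ↔ ∫⁻ ω, (Z ω 0 k : ℝ≥0∞) ^ α ∂P = 0 := by
  have hz := ht h k
  unfold thetaCompLaw at hz
  have key : ∀ s t, ∫⁻ ω, (Z ω t k : ℝ≥0∞) ^ α ∂P = 0 →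
      ∫⁻ f, (f t k : ℝ≥0∞) ^ α ∂(tiltedLaw α (fun f => f s k) Z P) = 0 := by
    intro s t h0
    rw [tiltedLaw_eq_smul, lintegral_smul_measure, crossMoment_eq_lintegral_tiltMeasure_left hα hZ,
      le_antisymm ((crossMoment_le P k s t).trans_eq h0) (zero_le)]
    simp
  by_cases h1 : ∫⁻ ω, (Z ω h k : ℝ≥0∞) ^ α ∂P = 0 <;>
    by_cases h2 : ∫⁻ ω, (Z ω 0 k : ℝ≥0∞) ^ α ∂P = 0
  · simp [h1, h2]
  · rw [if_pos h1, if_neg h2] at hz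
    -- After the shift by `h`, evaluation at `h + h` becomes evaluation at `h`, where the moment
    -- vanishes.
    have e := congrArg (fun μ => ∫⁻ f : PathSpace p d, (f (h + h) k : ℝ≥0∞) ^ α ∂μ) hz
    rw [lintegral_rpow_dirac_one α _ k hα,
      lintegral_map (isHomogeneousFunctional_apply hα _ k).measurable (measurable_shift h)] at e
    simp only [shift_apply, add_sub_cancel_right] at e
    rw [key 0 h h1] at e
    exact absurd e one_ne_zero
  · rw [if_neg h1, if_pos h2, Measure.map_dirac' (measurable_shift h)] at hz
    have e := congrArg (fun μ => ∫⁻ f : PathSpace p d, (f 0 k : ℝ≥0∞) ^ α ∂μ) hz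
    rw [key h 0 h2] at e
    have e' := e.trans (lintegral_rpow_dirac_one (p := p) α 0 k hα)
    exact absurd e'.symm one_ne_zero
  · simp [h1, h2]

lemma HasThetaShift.hasShiftFormula {α : ℝ} (hα : 0 < α) {Z : Ω → PathSpace p d}
    (hZ : Measurable Z) {P : Measure Ω} {B : ℝ≥0∞} (hB : B ≠ ∞)
    (hbd : ∀ t k, ∫⁻ ω, (Z ω t k : ℝ≥0∞) ^ α ∂P ≤ B) (ht : HasThetaShift α Z P) :
    HasShiftFormula α Z P := by
  rw [hasShiftFormula_iff_tiltMeasure hα hZ]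
  have hfin : ∀ t k, ∫⁻ ω, (Z ω t k : ℝ≥0∞) ^ α ∂P ≠ ∞ := fun t k => ne_top_of_le_ne_top hB (hbd t k)
  intro h k
  set c : (Fin p → ℝ) → ℝ≥0∞ := fun t => ∫⁻ ω, (Z ω t k : ℝ≥0∞) ^ α ∂P with hc
  have hcfin : ∀ t, c t ≠ ∞ := fun t => hfin t k
  set τ : (Fin p → ℝ) → Measure (PathSpace p d) := fun t => tiltMeasure α (fun f => f t k) Z P with hτ
  have hτuniv : ∀ t, τ t univ = c t := fun t => tiltMeasure_univ α (measurable_eval_apply t k) hZ P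
  have hziff : ∀ t, c t = 0 ↔ c 0 = 0 := fun t => ht.moment_eq_zero_iff hα hZ t k
  change τ h = (τ 0).map (shift h)
  by_cases hc0 : c 0 = 0
  · rw [Measure.measure_univ_eq_zero.1 ((hτuniv h).trans ((hziff h).2 hc0)),
      Measure.measure_univ_eq_zero.1 ((hτuniv 0).trans hc0), Measure.map_zero]
  have hcne : ∀ t, c t ≠ 0 := fun t ht0 => hc0 ((hziff t).1 ht0)
  -- Undoing the normalisation in (iii) leaves this ratio as the only obstruction to the shift
  -- formula.
  set r : (Fin p → ℝ) → ℝ≥0∞ := fun t => c t * (c 0)⁻¹ with hr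
  have hτr : ∀ t, τ t = r t • (τ 0).map (shift t) := by
    intro t
    have h1 := ht t k
    unfold thetaCompLaw at h1
    rw [if_neg (hcne t), if_neg hc0, tiltedLaw_eq_smul, tiltedLaw_eq_smul, Measure.map_smul] at h1
    have h2 := congrArg (fun μ => c t • μ) h1
    simp only [smul_smul] at h2
    rw [show c t * (∫⁻ ω, (Z ω t k : ℝ≥0∞) ^ α ∂P)⁻¹ = 1 from
      ENNReal.mul_inv_cancel (hcne t) (hcfin t), one_smul] at h2
    exact h2
  have hr0 : r 0 = 1 := ENNReal.mul_inv_cancel hc0 (hcfin 0)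
  have e1 : ∀ s t, crossMoment α Z P k s t = r s * crossMoment α Z P k 0 (t - s) := by
    intro s t
    rw [← crossMoment_eq_lintegral_tiltMeasure_left hα hZ,
      ← crossMoment_eq_lintegral_tiltMeasure_left hα hZ]
    change ∫⁻ f, (f t k : ℝ≥0∞) ^ α ∂(τ s) = r s * ∫⁻ f, (f (t - s) k : ℝ≥0∞) ^ α ∂(τ 0)
    rw [hτr s, lintegral_smul_measure,
      lintegral_map (isHomogeneousFunctional_apply hα _ k).measurable (measurable_shift s)]
    rfl
  have e2 : ∀ s t, crossMoment α Z P k s t = r t * crossMoment α Z P k (s - t) 0 := by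
    intro s t
    rw [← crossMoment_eq_lintegral_tiltMeasure_right hα hZ,
      ← crossMoment_eq_lintegral_tiltMeasure_right hα hZ]
    change ∫⁻ f, {f : PathSpace p d | f s k ≠ 0}.indicator 1 f ∂(τ t) =
      r t * ∫⁻ f, {f : PathSpace p d | f (s - t) k ≠ 0}.indicator 1 f ∂(τ 0)
    rw [hτr t, lintegral_smul_measure,
      lintegral_map (isHomogeneousFunctional_indicator_ne_zero _ k).measurable (measurable_shift t)]
    rfl
  -- `e1` and `e2` evaluate the cross moment from `s` to `s + u` as `r s * r u` and as `r (s + u)`,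
  -- each times the same factor, which may be cancelled when non-zero.
  have hmul : ∀ u, crossMoment α Z P k (-u) 0 ≠ 0 → ∀ s, r (s + u) = r s * r u := by
    intro u hu s
    have h1 := e1 s (s + u)
    rw [e2 s (s + u), e2 0 (s + u - s), add_sub_cancel_left, sub_add_cancel_left, zero_sub,
      ← mul_assoc] at h1
    exact (ENNReal.mul_left_inj hu
      (ne_top_of_le_ne_top (hcfin 0) (crossMoment_le P k _ 0))).1 h1
  have hpow : ∀ u, crossMoment α Z P k (-u) 0 ≠ 0 → ∀ n : ℕ, r ((n : ℝ) • u) = r u ^ n := by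
    intro u hu n
    induction n with
    | zero => simp [hr0]
    | succ n ih => rw [Nat.cast_succ, add_smul, one_smul, hmul u hu, ih, pow_succ]
  -- Otherwise the powers `r (n u) = r u ^ n` would exceed the uniform bound on the moments.
  have hle : ∀ u, crossMoment α Z P k (-u) 0 ≠ 0 → r u ≤ 1 := by
    intro u hu
    by_contra hgt
    have hlim := ENNReal.tendsto_pow_atTop_nhds_top_iff.2 (not_le.1 hgt)
    have hb : ∀ n : ℕ, r u ^ n ≤ B * (c 0)⁻¹ := fun n => by
      rw [← hpow u hu n]
      exact mul_le_mul_left (hbd _ k) _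
    have := le_of_tendsto' hlim hb
    exact ENNReal.mul_ne_top hB (ENNReal.inv_ne_top.2 hc0) (top_le_iff.1 this)
  have hdiv : ∀ v, ∃ n : ℕ, crossMoment α Z P k (-((1 / ((n : ℝ) + 1)) • v)) 0 ≠ 0 ∧
      r v = r ((1 / ((n : ℝ) + 1)) • v) ^ (n + 1) := by
    intro v
    obtain ⟨n, hn⟩ := exists_crossMoment_ne_zero hα hZ P k hc0 v
    refine ⟨n, hn, ?_⟩
    rw [← hpow _ hn, smul_smul, Nat.cast_succ, mul_one_div_cancel (by positivity), one_smul]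
  have hle1 : ∀ v, r v ≤ 1 := by
    intro v
    obtain ⟨n, hn, he⟩ := hdiv v
    rw [he]
    exact pow_le_one₀ (zero_le) (hle _ hn)
  -- For the small increment `u`, `1 = r (-u) * r u` with both factors at most `1`, so `r u = 1`,
  -- and `r h` is a power of it.
  have hr1 : r h = 1 := by
    obtain ⟨n, hn, he⟩ := hdiv h
    set u := (1 / ((n : ℝ) + 1)) • h
    have h1 := hmul u hn (-u)
    rw [neg_add_cancel, hr0] at h1
    have h2 : 1 ≤ r u := h1.le.trans (mul_le_of_le_one_left (zero_le) (hle1 _))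
    rw [he, le_antisymm (hle1 u) h2, one_pow]
  rw [hτr h, hr1, one_smul]

end MaxStable

/-! ### From the processes `Z_W` to stationarity. -/

namespace MaxStable
open Set Filter Topology

variable {p d : ℕ}

lemma continuous_maxFun_shift (F : Finset (((Fin p → ℝ) × Fin d) × ℝ≥0)) (f : PathSpace p d) :
    Continuous fun h => maxFun F (shift h f) := by
  classical
  unfold maxFun
  induction F using Finset.induction_on with
  | empty => simpa using continuous_const
  | insert a F _ ih =>
    simp only [Finset.sup_insert, shift_apply]
    exact Continuous.sup (by fun_prop) ih

lemma denseRange_ratPoint : DenseRange (ratPoint (p := p)) :=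
  DenseRange.piMap fun _ : Fin p => Rat.denseRange_cast (𝕜 := ℝ)

lemma ratPoint_add (a b : Fin p → ℚ) : ratPoint (a + b) = ratPoint a + ratPoint b := by
  ext j; simp [ratPoint]

variable {Ω' : Type*} [MeasurableSpace Ω']

/-- Invariance in law under the shifts from a dense set implies stationarity. -/
lemma isStationary_of_ratPoint {X : Ω' → PathSpace p d} (hX : Measurable X)
    {Q : Measure Ω'} [IsProbabilityMeasure Q]
    (hs : ∀ q F, Q {ω | maxFun F (shift (ratPoint q) (X ω)) ≤ 1} = Q {ω | maxFun F (X ω) ≤ 1}) :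
    IsStationary X Q := by
  rw [isStationary_iff_forall_maxFun hX]
  intro h F
  have hXs : ∀ h, Measurable fun ω => shift h (X ω) := fun h => (measurable_shift h).comp hX
  have hM : ∀ h, Measurable fun ω => maxFun F (shift h (X ω)) := fun h =>
    (measurable_maxFun F).comp (hXs h)
  have hM0 : Measurable fun ω => maxFun F (X ω) := (measurable_maxFun F).comp hX
  obtain ⟨u, hu, hlim⟩ := mem_closure_iff_seq_limit.1 (denseRange_ratPoint h)
  -- The probability of `{maxFun F ≤ 1}` need not be continuous along the approximating shifts, so
  -- the whole law of `maxFun F` is compared through bounded continuous test functions.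
  have hlaw : Q.map (fun ω => maxFun F (shift h (X ω))) = Q.map fun ω => maxFun F (X ω) := by
    have := Measure.isProbabilityMeasure_map (μ := Q) (hM h).aemeasurable
    have := Measure.isProbabilityMeasure_map (μ := Q) hM0.aemeasurable
    refine ext_of_forall_lintegral_eq_of_IsFiniteMeasure fun g => ?_
    have hg : Measurable fun x => (g x : ℝ≥0∞) := g.continuous.measurable.coe_nnreal_ennreal
    have hconst : ∀ n, ∫⁻ ω, (g (maxFun F (shift (u n) (X ω))) : ℝ≥0∞) ∂Q =
        ∫⁻ ω, (g (maxFun F (X ω)) : ℝ≥0∞) ∂Q := by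
      intro n
      obtain ⟨q, hq⟩ := hu n
      rw [← hq]
      have hl := (map_path_eq_iff_forall_maxFun (hXs (ratPoint q)) hX).2 (hs q)
      have hgM : Measurable fun f : PathSpace p d => (g (maxFun F f) : ℝ≥0∞) :=
        hg.comp (measurable_maxFun F)
      rw [← lintegral_map hgM (hXs (ratPoint q)), hl, lintegral_map hgM hX]
    rw [lintegral_map hg (hM h), lintegral_map hg hM0]
    refine tendsto_nhds_unique (f := fun n => ∫⁻ ω, (g (maxFun F (shift (u n) (X ω))) : ℝ≥0∞) ∂Q)
      (l := atTop) ?_ (tendsto_const_nhds.congr fun n => (hconst n).symm)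
    refine tendsto_lintegral_of_dominated_convergence (fun _ => (nndist g 0 : ℝ≥0∞))
      (fun n => hg.comp (hM _)) (fun n => Eventually.of_forall fun ω => ?_) ?_
      (Eventually.of_forall fun ω => ?_)
    · exact ENNReal.coe_le_coe.2 (BoundedContinuousFunction.NNReal.upper_bound g _)
    · simp
    · refine ENNReal.tendsto_coe.2 ((g.continuous.tendsto _).comp ?_)
      exact ((continuous_maxFun_shift F (X ω)).tendsto h).comp hlim
  have := congrArg (fun μ => μ (Iic 1)) hlaw
  simp only [Measure.map_apply (hM h) measurableSet_Iic, Measure.map_apply hM0 measurableSet_Iic]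
    at this
  exact this

variable {S : Type*} [MeasurableSpace S]

lemma IsSpectralProcess.shift {α : ℝ} {Z : S → PathSpace p d} (hZ : Measurable Z) {R : Measure S}
    [IsProbabilityMeasure R] {X : Ω' → PathSpace p d} (hX : Measurable X) {Q : Measure Ω'}
    (hXZ : IsSpectralProcess α Z R X Q) (h : Fin p → ℝ) :
    IsSpectralProcess α (fun ω => shift h (Z ω)) R (fun ω => shift h (X ω)) Q := by
  have hT : Measurable fun (e : (Fin p → ℝ) → Fin d → ℝ≥0∞) t => e (t - h) := by fun_prop
  have := congrArg (fun μ => μ.map fun (e : (Fin p → ℝ) → Fin d → ℝ≥0∞) t => e (t - h)) hXZ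
  rw [Measure.map_map hT (measurable_coe_path hX),
    Measure.map_map hT (measurable_deHaanSup α hZ)] at this
  exact this

/-- Since `W + q = s` means `W = s - q`, reindexing the normalising sum by `s ↦ s + q` removes `q`
from it. -/
lemma shiftedNormalised_add (α : ℝ) (N : Seminorm ℝ (Fin d → ℝ)) (Θ : S → PathSpace p d)
    (W : S → Fin p → ℚ) (R : Measure S) (q : Fin p → ℚ) (ω : S) :
    shiftedNormalised α N Θ (fun ω => W ω + q) R ω =
      shift (ratPoint q) (shiftedNormalised α N Θ W R ω) := by
  unfold shiftedNormalised
  rw [shift_smul, shift_shift, ratPoint_add, add_comm (ratPoint q)]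
  congr 4
  rw [← (Equiv.addRight q).tsum_eq]
  refine tsum_congr fun s => ?_
  simp only [Equiv.coe_addRight, ratPoint_add, add_sub_add_right_eq_sub]
  congr 2
  ext ω
  simp

lemma measurable_comp_countable {ι β : Type*} [Countable ι] [MeasurableSpace ι]
    [MeasurableSingletonClass ι] [MeasurableSpace β] {g : ι → S → β} (hg : ∀ i, Measurable (g i))
    {W : S → ι} (hW : Measurable W) : Measurable fun ω => g (W ω) ω :=
  (measurable_from_prod_countable_right (f := fun x : ι × S => g x.1 x.2) hg).comp
    (hW.prodMk measurable_id)

lemma measurable_shiftedNormalised (α : ℝ) (N : Seminorm ℝ (Fin d → ℝ)) {Θ : S → PathSpace p d}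
    (hΘ : Measurable Θ) {W : S → Fin p → ℚ} (hW : Measurable W) (R : Measure S) :
    Measurable (shiftedNormalised α N Θ W R) := by
  unfold shiftedNormalised
  refine measurable_smul_path (Measurable.ennreal_toNNReal (Measurable.inv
    (Measurable.pow_const (Measurable.tsum fun s => ?_) _))) ?_
  · refine Measurable.mul_const (Measurable.pow_const (Measurable.coe_nnreal_ennreal ?_) _) _
    exact measurable_comp_countable (g := fun w ω => normAt N (ratPoint s - ratPoint w) (Θ ω))
      (fun w => (measurable_normAt N _).comp hΘ) hW
  · exact measurable_comp_countable (g := fun w ω => MaxStable.shift (ratPoint w) (Θ ω))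
      (fun w => (measurable_shift _).comp hΘ) hW

lemma exists_isProbabilityMeasure_singleton_pos (ι : Type*) [Countable ι] [Nonempty ι]
    [MeasurableSpace ι] [MeasurableSingletonClass ι] :
    ∃ μ : Measure ι, IsProbabilityMeasure μ ∧ ∀ i, 0 < μ {i} := by
  obtain ⟨f, hf, hsum⟩ := ENNReal.exists_pos_sum_of_countable one_ne_zero ι
  have h0 : ∑' i, (f i : ℝ≥0∞) ≠ 0 := by
    obtain ⟨i⟩ := ‹Nonempty ι›
    refine fun h => (hf i).ne' ?_
    exact_mod_cast (ENNReal.tsum_eq_zero.1 h) i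
  refine ⟨(PMF.normalize (fun i => (f i : ℝ≥0∞)) h0 (hsum.trans ENNReal.one_lt_top).ne).toMeasure,
    PMF.toMeasure.isProbabilityMeasure _, fun i => ?_⟩
  rw [PMF.toMeasure_apply_singleton _ _ (measurableSet_singleton i), PMF.normalize_apply]
  refine ENNReal.mul_pos (by exact_mod_cast (hf i).ne') (ENNReal.inv_ne_zero.2 ?_)
  exact (hsum.trans ENNReal.one_lt_top).ne

/-- If every `Z_W` is a spectral process of `X`, then `X` is stationary. -/
lemma isStationary_of_shiftedNormalised {α : ℝ} {N : Seminorm ℝ (Fin d → ℝ)}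
    {X : Ω' → PathSpace p d} (hX : Measurable X) {Q : Measure Ω'} [IsProbabilityMeasure Q]
    (ν : Measure (PathSpace p d)) [IsProbabilityMeasure ν]
    (H : ∀ (S : Type) [MeasurableSpace S] (R : Measure S) [IsProbabilityMeasure R]
        (Θ : S → PathSpace p d) (W : S → Fin p → ℚ),
        Measurable Θ → Measurable W → IndepFun Θ W R → R.map Θ = ν →
        (∀ s, 0 < R (W ⁻¹' {s})) →
        IsSpectralProcess α (shiftedNormalised α N Θ W R) R X Q) :
    IsStationary X Q := by
  obtain ⟨μ, hμ, hpos⟩ := exists_isProbabilityMeasure_singleton_pos (Fin p → ℚ)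
  have hlaw : (ν.prod μ).map Prod.fst = ν := by simp
  have hsnd : ∀ A, MeasurableSet A → (ν.prod μ) (Prod.snd ⁻¹' A) = μ A := fun A hA =>
    (measurePreserving_snd (μ := ν) (ν := μ)).measure_preimage hA.nullMeasurableSet
  have hind : IndepFun (Prod.fst : PathSpace p d × (Fin p → ℚ) → _) Prod.snd (ν.prod μ) :=
    indepFun_prod (X := id) (Y := id) measurable_id measurable_id
  have h0 := H _ (ν.prod μ) Prod.fst Prod.snd measurable_fst measurable_snd hind hlaw fun s => by
    rw [hsnd _ (measurableSet_singleton s)]; exact hpos s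
  refine isStationary_of_ratPoint hX fun q F => ?_
  have hadd : Measurable fun s : Fin p → ℚ => s + q := measurable_of_countable _
  -- `W + q` is again admissible, so `Z_{W+q} = B^q Z_W` is a spectral process of `X`; it is also
  -- one of `B^q X`.
  have hq := H _ (ν.prod μ) Prod.fst (fun ω => ω.2 + q) measurable_fst (hadd.comp measurable_snd)
    (hind.comp measurable_id hadd) hlaw fun s => by
      have : (fun ω : PathSpace p d × (Fin p → ℚ) => ω.2 + q) ⁻¹' {s} = Prod.snd ⁻¹' {s - q} := by
        ext ω; simp [eq_sub_iff_add_eq]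
      rw [this, hsnd _ (measurableSet_singleton _)]; exact hpos _
  have hsh := h0.shift (measurable_shiftedNormalised α N measurable_fst measurable_snd _) hX
    (ratPoint q)
  have hfun : shiftedNormalised α N Prod.fst (fun ω : PathSpace p d × (Fin p → ℚ) => ω.2 + q)
      (ν.prod μ) = fun ω => shift (ratPoint q)
        (shiftedNormalised α N Prod.fst Prod.snd (ν.prod μ) ω) :=
    funext fun ω => shiftedNormalised_add α N Prod.fst Prod.snd (ν.prod μ) q ω
  rw [hfun] at hq
  have hXs : Measurable fun ω => shift (ratPoint q) (X ω) := (measurable_shift _).comp hX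
  rw [← map_coe_path_box hXs, ← map_coe_path_box hX]
  congr 1
  exact Eq.trans hsh (Eq.symm hq)

end MaxStable

/-! ### From the shift formula to the processes `Z_W`. -/

namespace MaxStable
open Set Filter Topology

variable {p d : ℕ}

/-- `∑_{s ∈ ℚᵖ} ‖f(s)‖^α q(s)`. -/
noncomputable def weightedNorm (α : ℝ) (N : Seminorm ℝ (Fin d → ℝ)) (q : (Fin p → ℚ) → ℝ≥0∞)
    (f : PathSpace p d) : ℝ≥0∞ :=
  ∑' s, (normAt N (ratPoint s) f : ℝ≥0∞) ^ α * q s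

lemma isHomogeneousFunctional_weightedNorm {α : ℝ} (hα : 0 < α) (N : Seminorm ℝ (Fin d → ℝ))
    (q : (Fin p → ℚ) → ℝ≥0∞) : IsHomogeneousFunctional α (weightedNorm α N q) := by
  have hn := fun s : Fin p → ℚ => isHomogeneousFunctional_rpow hα (measurable_normAt N (ratPoint s))
    (normAt_smul N (ratPoint s))
  refine ⟨Measurable.tsum fun s => (hn s).measurable.mul_const _, fun c f hc => ?_⟩
  unfold weightedNorm
  rw [← ENNReal.tsum_mul_left]
  refine tsum_congr fun s => ?_
  rw [(hn s).map_smul c f hc, mul_assoc]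

/-- `(maxFun F f)^α / weightedNorm f`, and `0` where the denominator is `0` or `∞`. -/
noncomputable def normalisedMax (α : ℝ) (N : Seminorm ℝ (Fin d → ℝ)) (q : (Fin p → ℚ) → ℝ≥0∞)
    (F : Finset (((Fin p → ℝ) × Fin d) × ℝ≥0)) (f : PathSpace p d) : ℝ≥0∞ :=
  (maxFun F (((weightedNorm α N q f) ^ (1 / α))⁻¹.toNNReal • f) : ℝ≥0∞) ^ α

lemma isHomogeneousFunctional_normalisedMax {α : ℝ} (hα : 0 < α) (N : Seminorm ℝ (Fin d → ℝ))
    (q : (Fin p → ℚ) → ℝ≥0∞) (F : Finset (((Fin p → ℝ) × Fin d) × ℝ≥0)) :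
    IsHomogeneousFunctional 0 (normalisedMax α N q F) := by
  have hD := isHomogeneousFunctional_weightedNorm hα N q
  refine ⟨?_, fun c f hc => ?_⟩
  · refine (((measurable_maxFun F).comp (measurable_smul_path ?_ measurable_id)).coe_nnreal_ennreal).pow_const _
    exact ((hD.measurable.pow_const _).inv).ennreal_toNNReal
  · have hc' : (c : ℝ≥0∞) ≠ 0 := by exact_mod_cast hc.ne'
    unfold normalisedMax
    rw [ENNReal.rpow_zero, one_mul, hD.map_smul c f hc, ENNReal.mul_rpow_of_nonneg _ _ (by positivity),
      ← ENNReal.rpow_mul, mul_one_div_cancel hα.ne', ENNReal.rpow_one,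
      ENNReal.mul_inv (Or.inl hc') (Or.inl ENNReal.coe_ne_top), ENNReal.toNNReal_mul, smul_smul,
      ENNReal.toNNReal_inv, ENNReal.toNNReal_coe, mul_right_comm, inv_mul_cancel₀ hc.ne', one_mul]

lemma normalisedMax_mul_weightedNorm {α : ℝ} (hα : 0 < α) {N : Seminorm ℝ (Fin d → ℝ)}
    {q : (Fin p → ℚ) → ℝ≥0∞} (F : Finset (((Fin p → ℝ) × Fin d) × ℝ≥0)) {f : PathSpace p d}
    (h0 : weightedNorm α N q f ≠ 0) (htop : weightedNorm α N q f ≠ ∞) :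
    normalisedMax α N q F f * weightedNorm α N q f = (maxFun F f : ℝ≥0∞) ^ α := by
  have h1 : weightedNorm α N q f ^ (1 / α) ≠ 0 :=
    (ENNReal.rpow_pos (pos_iff_ne_zero.2 h0) htop).ne'
  have hα' : α⁻¹ * α = 1 := inv_mul_cancel₀ hα.ne'
  unfold normalisedMax
  rw [maxFun_smul, ENNReal.coe_mul, ENNReal.coe_toNNReal (ENNReal.inv_ne_top.2 h1),
    ENNReal.mul_rpow_of_nonneg _ _ hα.le, ENNReal.inv_rpow, ← ENNReal.rpow_mul, one_div, hα',
    ENNReal.rpow_one, mul_right_comm, ENNReal.inv_mul_cancel h0 htop, one_mul]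

/-- By continuity a path that is not identically zero is non-zero on an open set, which contains a
rational point, and that point carries positive weight. -/
lemma weightedNorm_ne_zero {α : ℝ} {N : Seminorm ℝ (Fin d → ℝ)}
    {q : (Fin p → ℚ) → ℝ≥0∞} (hq : ∀ s, 0 < q s) {f : PathSpace p d}
    (hf : 0 < ⨆ t, (normAt N t f : ℝ≥0∞)) : weightedNorm α N q f ≠ 0 := by
  obtain ⟨t, ht⟩ := lt_iSup_iff.1 hf
  have hopen : IsOpen {t | normAt N t f ≠ 0} := isOpen_ne_fun (continuous_normAt N f) continuous_const
  obtain ⟨s, hs⟩ := denseRange_ratPoint.exists_mem_open hopen ⟨t, by exact_mod_cast ht.ne'⟩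
  intro h
  have h1 := (ENNReal.tsum_eq_zero.1 h) s
  rcases mul_eq_zero.1 h1 with h2 | h2
  · have : (normAt N (ratPoint s) f : ℝ≥0∞) ≠ 0 := by exact_mod_cast hs
    exact (ENNReal.rpow_pos (pos_iff_ne_zero.2 this) ENNReal.coe_ne_top).ne' h2
  · exact (hq s).ne' h2

variable {Ω : Type*} [MeasurableSpace Ω] {S : Type*} [MeasurableSpace S]

/-- The norm at `w` vanishes with the `d` coordinates at `w`, so `HasShiftFormula.lintegral_shift`
applies to `f ↦ ‖f(w)‖^α Γ(f)`. -/
lemma lintegral_normAt_mul_shift {α : ℝ} (hα : 0 < α) (N : Seminorm ℝ (Fin d → ℝ))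
    {Z : Ω → PathSpace p d} (hZ : Measurable Z) {P : Measure Ω} (hs : HasShiftFormula α Z P)
    {Γ : PathSpace p d → ℝ≥0∞} (hΓ : IsHomogeneousFunctional 0 Γ) (w : Fin p → ℝ) :
    ∫⁻ ω, (normAt N 0 (Z ω) : ℝ≥0∞) ^ α * Γ (shift w (Z ω)) ∂P =
      ∫⁻ ω, (normAt N w (Z ω) : ℝ≥0∞) ^ α * Γ (Z ω) ∂P := by
  classical
  have hn := isHomogeneousFunctional_rpow hα (measurable_normAt N w) (normAt_smul N w)
  have hH := hn.mul hΓ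
  rw [add_zero] at hH
  have := hs.lintegral_shift hα hZ (Finset.univ.image fun k : Fin d => ((w, k), (1 : ℝ≥0))) hH
    (fun f hf => ?_) w
  · simpa [normAt_shift] using this
  · have hz : ∀ k, f w k = 0 := by
      intro k
      have h1 := (Finset.sum_eq_zero_iff.1 hf) ((w, k), 1) (by simp)
      simpa [hα, hα.le, hα.ne', not_lt.2 hα.le] using h1
    have : normAt N w f = 0 := by
      unfold normAt
      have : (fun k => (f w k : ℝ)) = 0 := by ext k; simp [hz k]
      rw [this, map_zero, Real.toNNReal_zero]
    simp [this, hα]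

lemma lintegral_thetaLaw {α : ℝ} (hα : 0 < α) {N : Seminorm ℝ (Fin d → ℝ)}
    {Z : Ω → PathSpace p d} (hZ : Measurable Z) {P : Measure Ω}
    (hnorm : ∀ t, ∫⁻ ω, (normAt N t (Z ω) : ℝ≥0∞) ^ α ∂P = 1)
    {Γ : PathSpace p d → ℝ≥0∞} (hΓ : IsHomogeneousFunctional 0 Γ) (t : Fin p → ℝ) :
    ∫⁻ f, Γ f ∂(thetaLaw α N Z P t) = ∫⁻ ω, (normAt N t (Z ω) : ℝ≥0∞) ^ α * Γ (Z ω) ∂P := by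
  rw [thetaLaw, tiltedLaw_eq_smul, hnorm, inv_one, one_smul,
    lintegral_tiltMeasure_of_homogeneous hα (measurable_normAt N t) hZ P hΓ]

lemma isProbabilityMeasure_thetaLaw {α : ℝ} {N : Seminorm ℝ (Fin d → ℝ)}
    {Z : Ω → PathSpace p d} (hZ : Measurable Z) {P : Measure Ω}
    (hnorm : ∀ t, ∫⁻ ω, (normAt N t (Z ω) : ℝ≥0∞) ^ α ∂P = 1) (t : Fin p → ℝ) :
    IsProbabilityMeasure (thetaLaw α N Z P t) := by
  refine ⟨?_⟩
  rw [thetaLaw, tiltedLaw_eq_smul, hnorm, inv_one, one_smul,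
    tiltMeasure_univ α (measurable_normAt N t) hZ P, hnorm]

/-- `E[(maxFun F Z_W)^α] = E[(maxFun F Z)^α]`. -/
lemma maxMoment_shiftedNormalised {α : ℝ} (hα : 0 < α) {N : Seminorm ℝ (Fin d → ℝ)}
    {Z : Ω → PathSpace p d} (hZ : Measurable Z) {P : Measure Ω} [IsProbabilityMeasure P]
    (hs : HasShiftFormula α Z P)
    (hsup : ∀ᵐ ω ∂P, 0 < ⨆ t, (normAt N t (Z ω) : ℝ≥0∞))
    (hnorm : ∀ t, ∫⁻ ω, (normAt N t (Z ω) : ℝ≥0∞) ^ α ∂P = 1)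
    {R : Measure S} [IsProbabilityMeasure R] {Θ : S → PathSpace p d} {W : S → Fin p → ℚ}
    (hΘ : Measurable Θ) (hW : Measurable W) (hind : IndepFun Θ W R)
    (hlaw : R.map Θ = thetaLaw α N Z P 0) (hpos : ∀ s, 0 < R (W ⁻¹' {s}))
    (F : Finset (((Fin p → ℝ) × Fin d) × ℝ≥0)) :
    maxMoment α (shiftedNormalised α N Θ W R) R F = maxMoment α Z P F := by
  set q : (Fin p → ℚ) → ℝ≥0∞ := fun s => R (W ⁻¹' {s}) with hq
  set K := normalisedMax α N q F
  have hK : IsHomogeneousFunctional 0 K := isHomogeneousFunctional_normalisedMax hα N q F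
  have hqmap : ∀ s, R.map W {s} = q s := fun s => Measure.map_apply hW (measurableSet_singleton s)
  have hRΘ := Measure.isProbabilityMeasure_map (μ := R) hΘ.aemeasurable
  have hRW := Measure.isProbabilityMeasure_map (μ := R) hW.aemeasurable
  have hqsum : ∑' s, q s = 1 := by
    have := lintegral_countable' (μ := R.map W) (fun _ => 1)
    simpa [hqmap] using this.symm
  have e1 : maxMoment α (shiftedNormalised α N Θ W R) R F =
      ∫⁻ ω, K (shift (ratPoint (W ω)) (Θ ω)) ∂(R) := rfl
  have hKm : Measurable fun x : PathSpace p d × (Fin p → ℚ) => K (shift (ratPoint x.2) x.1) :=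
    measurable_from_prod_countable_left fun w => hK.measurable.comp (measurable_shift (ratPoint w))
  -- Independence separates `W` from `Θ`; for each value `w`, moving the shift off `K` replaces the
  -- weight `‖Z(0)‖^α` by `‖Z(w)‖^α`.
  have e2 : ∫⁻ ω, K (shift (ratPoint (W ω)) (Θ ω)) ∂(R) =
      ∑' w, q w * ∫⁻ ω, (normAt N (ratPoint w) (Z ω) : ℝ≥0∞) ^ α * K (Z ω) ∂P := by
    have h1 := (indepFun_iff_map_prod_eq_prod_map_map hΘ.aemeasurable hW.aemeasurable).1 hind
    have h2 := lintegral_map (μ := R) hKm (hΘ.prodMk hW)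
    rw [h1, lintegral_prod_symm _ hKm.aemeasurable, lintegral_countable'] at h2
    rw [← h2]
    refine tsum_congr fun w => ?_
    rw [hqmap, mul_comm, hlaw, lintegral_thetaLaw hα hZ hnorm (hK.comp_shift (ratPoint w)),
      lintegral_normAt_mul_shift hα N hZ hs hK]
  have hnm : ∀ w, Measurable fun ω => (normAt N w (Z ω) : ℝ≥0∞) ^ α := fun w =>
    (((measurable_normAt N w).comp hZ).coe_nnreal_ennreal).pow_const α
  have hKZ : Measurable fun ω => K (Z ω) := hK.measurable.comp hZ
  have hDint : ∫⁻ ω, weightedNorm α N q (Z ω) ∂P = 1 := by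
    unfold weightedNorm
    rw [lintegral_tsum fun s => ((hnm _).mul_const _).aemeasurable, ← hqsum]
    refine tsum_congr fun s => ?_
    rw [lintegral_mul_const _ (hnm _), hnorm, one_mul]
  have hDm : Measurable fun ω => weightedNorm α N q (Z ω) :=
    (isHomogeneousFunctional_weightedNorm hα N q).measurable.comp hZ
  have hDfin : ∀ᵐ ω ∂P, weightedNorm α N q (Z ω) < ∞ := ae_lt_top hDm (by simp [hDint])
  rw [e1, e2]
  have hprod : ∀ w, Measurable fun ω => (normAt N (ratPoint w) (Z ω) : ℝ≥0∞) ^ α * K (Z ω) :=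
    fun w => (hnm _).mul hKZ
  rw [tsum_congr fun w => (lintegral_const_mul (q w) (hprod w)).symm,
    ← lintegral_tsum fun w => ((hprod w).const_mul _).aemeasurable]
  -- Summed over `w`, the weights give `weightedNorm`, which cancels the denominator of `K`. It is
  -- almost surely finite because its mean is `∑ q = 1`.
  refine lintegral_congr_ae ?_
  filter_upwards [hsup, hDfin] with ω h1 h2
  rw [← normalisedMax_mul_weightedNorm hα F (weightedNorm_ne_zero hpos h1) h2.ne, weightedNorm,
    ← ENNReal.tsum_mul_left]
  refine tsum_congr fun w => ?_
  change q w * (_ * K (Z ω)) = K (Z ω) * (_ * q w)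
  ring

end MaxStable

theorem mainTheorem2 {p d : ℕ} (hp : 0 < p) (hd : 0 < d) (α : ℝ) (hα : 0 < α)
    (N : Seminorm ℝ (Fin d → ℝ)) (hN : ∀ x, N x = 0 → x = 0)
    {Ω : Type*} [MeasurableSpace Ω] (P : Measure Ω) [IsProbabilityMeasure P]
    (Z : Ω → MaxStable.PathSpace p d) (hZ : Measurable Z)
    {Ω' : Type*} [MeasurableSpace Ω'] (Q : Measure Ω') [IsProbabilityMeasure Q]
    (X : Ω' → MaxStable.PathSpace p d) (hX : Measurable X)
    (hXZ : MaxStable.IsSpectralProcess α Z P X Q)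
    (hsup : ∀ᵐ ω ∂P, 0 < ⨆ t, (MaxStable.normAt N t (Z ω) : ℝ≥0∞))
    (hnorm : ∀ t, ∫⁻ ω, (MaxStable.normAt N t (Z ω) : ℝ≥0∞) ^ α ∂P = 1) :
    (MaxStable.IsStationary X Q ↔
      ∀ (S : Type) [MeasurableSpace S] (R : Measure S) [IsProbabilityMeasure R]
        (Θ : S → MaxStable.PathSpace p d) (W : S → Fin p → ℚ),
        Measurable Θ → Measurable W → IndepFun Θ W R →
        R.map Θ = MaxStable.thetaLaw α N Z P 0 →
        (∀ s, 0 < R (W ⁻¹' {s})) →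
        MaxStable.IsSpectralProcess α (MaxStable.shiftedNormalised α N Θ W R) R X Q) ∧
    (MaxStable.IsStationary X Q ↔
      ∀ (h : Fin p → ℝ) (Γ : MaxStable.PathSpace p d → ℝ≥0∞) (k : Fin d),
        MaxStable.IsHomogeneousFunctional 0 Γ →
        ∫⁻ ω, (Z ω h k : ℝ≥0∞) ^ α * Γ (Z ω) ∂P =
          ∫⁻ ω, (Z ω 0 k : ℝ≥0∞) ^ α * Γ (MaxStable.shift h (Z ω)) ∂P) ∧
    (MaxStable.IsStationary X Q ↔
      ∀ (h : Fin p → ℝ) (k : Fin d),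
        MaxStable.thetaCompLaw α Z P h k =
          (MaxStable.thetaCompLaw α Z P 0 k).map (MaxStable.shift h)) := by
  obtain ⟨C, hC⟩ := MaxStable.exists_apply_le_normAt (p := p) N hN
  -- Besides finiteness of all moments, the uniformity in `t` is essential: it excludes exponential
  -- growth of the ratio `r` in the step from (iii) to (ii).
  have hbd : ∀ t k, ∫⁻ ω, (Z ω t k : ℝ≥0∞) ^ α ∂P ≤ (C : ℝ≥0∞) ^ α := by
    intro t k
    have hm : Measurable fun ω => (MaxStable.normAt N t (Z ω) : ℝ≥0∞) ^ α :=
      (((MaxStable.measurable_normAt N t).comp hZ).coe_nnreal_ennreal).pow_const α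
    calc ∫⁻ ω, (Z ω t k : ℝ≥0∞) ^ α ∂P
        ≤ ∫⁻ ω, (C : ℝ≥0∞) ^ α * (MaxStable.normAt N t (Z ω) : ℝ≥0∞) ^ α ∂P := by
          refine lintegral_mono fun ω => ?_
          rw [← ENNReal.mul_rpow_of_nonneg _ _ hα.le]
          exact ENNReal.rpow_le_rpow (by exact_mod_cast hC t k (Z ω)) hα.le
      _ = (C : ℝ≥0∞) ^ α := by rw [lintegral_const_mul _ hm, hnorm, mul_one]
  have hCtop : (C : ℝ≥0∞) ^ α ≠ ∞ := ENNReal.rpow_ne_top_of_nonneg hα.le ENNReal.coe_ne_top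
  have hfin := MaxStable.maxMoment_ne_top hα hZ (P := P)
    fun t k => ne_top_of_le_ne_top hCtop (hbd t k)
  have hii : MaxStable.IsStationary X Q ↔ MaxStable.HasShiftFormula α Z P := by
    rw [MaxStable.isStationary_iff_maxMoment hα hZ hX hfin hXZ]
    exact ⟨MaxStable.hasShiftFormula_of_maxMoment_shift hα hZ hfin,
      fun hs h F => hs.maxMoment_shift hα hZ h F⟩
  refine ⟨⟨fun hst S _ R _ Θ W hΘ hW hind hlaw hpos => ?_, fun H => ?_⟩, hii,
    hii.trans ⟨fun hs => hs.hasThetaShift hα hZ,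
      fun ht => MaxStable.HasThetaShift.hasShiftFormula hα hZ hCtop hbd ht⟩⟩
  · have hmom := MaxStable.maxMoment_shiftedNormalised hα hZ (hii.1 hst) hsup hnorm hΘ hW hind
      hlaw hpos
    rw [MaxStable.isSpectralProcess_iff hα (MaxStable.measurable_shiftedNormalised α N hΘ hW R) hX
      fun F => hmom F ▸ hfin F]
    intro F
    rw [hmom]
    exact (MaxStable.isSpectralProcess_iff hα hZ hX hfin).1 hXZ F
  · have := MaxStable.isProbabilityMeasure_thetaLaw hZ hnorm 0
    exact MaxStable.isStationary_of_shiftedNormalised hX _ H
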